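/- **Setting.** Let $N,T\ge 1$ with $NT\ge 2$, let $L=\lfloor\sqrt{\min(N,T)\,T}\rfloor$ and assume $L\mid T$. For a family $x=(x_n(t))_{n\in[N],\,t\in[T]}$ of real numbers let $\mathsf{SP}(x)\in\mathbb R^{L\times (NT/L)}$ be its stacked Page matrix, whose entry in row $i\in[L]$ and column $(n-1)T/L+j$ ($n\in[N]$, $j\in[T/L]$) is $x_n(i+(j-1)L)$. *mSSA with parameters $L$ and $k$* (imputation) takes data $X_n(t)$, some of which may be missing, replaces missing entries by $0$, computes a singular value decomposition $\sum_{\ell} s_\ell u_\ell v_\ell^{T}$ (with $s_1\ge s_2\ge\dots\ge 0$) of the stacked Page matrix, and reads off the estimates from the matrix $\hat\rho^{-1}\sum_{\ell\le k}s_\ell u_\ell v_\ell^{T}$, where $\hat\rho=\max(1,\#\{\text{observed entries}\})/(NT)$: the estimate for $(n,t)$ is the entry in row $((t-1)\bmod L)+1$ and column $(n-1)T/L+\lceil t/L\rceil$. **Model.** Every entry is observed ($\rho=1$): $X_n(t)=f_n(t)+\eta_n(t)$ for $n\in[N]$, $t\in[T]$, with $f_n(t)$ deterministic and $\eta_n(t)$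 independent random variables with $\mathbb E\,\eta_n(t)=0$ and $\|\eta_n(t)\|_{\psi_2}=\sup_{p\ge1}p^{-1/2}(\mathbb E|\eta_n(t)|^p)^{1/p}\le\gamma$. Put $\sigma_n^2(t)=\mathbb E[\eta_n(t)^2]$. Let $\Gamma_1,\Gamma_2,\Gamma_1',\Gamma_2',c>0$, let $G\ge1$ and let $R,R',G'$ be non-negative integers, and assume: 1. (Factor model for the mean) the $N\times T$ matrix $(f_n(t))$ has rank $R$, and $f_n(t)=\sum_{r=1}^R U_{nr}W_{rt}$ for all $n\in[N],t\in[T]$, with $|U_{nr}|\le\Gamma_1$, $|W_{rt}|\le\Gamma_2$, and for each $r$ the Hankel matrix $(W_{r,i+j-1})_{i,j=1}^{\lfloor T/2\rfloor}$ has rank at most $G$. 2. (Factor model for the variance) the same holds for the $N\times T$ matrix $(\sigma_n^2(t))$ with $R',G',\Gamma_1',\Gamma_2'$ in place of $R,G,\Gamma_1,\Gamma_2$. 3. (Balanced spectra) for $x=f$ and for $x=\sigma^2$, $\mathsf{SP}(x)$ has rank $k_x\ge1$ and its $k_x$-th largest singular value is at least $c\sqrt{NT}/\sqrt{k_x}$.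 **Theorem (variance estimation).** There is a polynomial $P$ in eight variables, not depending on any of the data above, with the following property. Let $\hat f_n(t)$ be (measurable) estimates produced by mSSA with parameters $L,k_1$ from the data $X_n(t)$, and $\hat g_n(t)$ (measurable) estimates produced by mSSA with parameters $L,k_2$ from the data $X_n(t)^2$, where $$\operatorname{rank}\mathsf{SP}(f)\le k_1\le\max\big(\operatorname{rank}\mathsf{SP}(f),\,(RG)^2+R'G'\big),$$ $$\operatorname{rank}\mathsf{SP}(f^2+\sigma^2)\le k_2\le\max\big(\operatorname{rank}\mathsf{SP}(f^2+\sigma^2),\,(RG)^2+R'G'\big).$$ Suppose $|\hat f_n(t)|\le\Gamma_3$ for all $n\in[N]$, $t\in[T]$ (almost surely), and let $\hat\sigma_n^2(t)=\max(0,\hat g_n(t)-\hat f_n(t)^2)$. Then all the expectations below are finite and $$\frac1{NT}\sum_{n=1}^N\sum_{t=1}^T\mathbb E\Big[\big(\sigma_n^2(t)-\hat\sigma_n^2(t)\big)^2\Big]\le \tilde C\;\frac{(G^2+G')\,\log^2(NT)}{\sqrt{\min(N,T)\,T}},\qquad \tilde C=P(\Gamma_1,\Gamma_2,\Gamma_3,\Gamma_1',\Gamma_2',\gamma,R,R').$$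 -/

import Mathlib

open MeasureTheory ProbabilityTheory
open scoped ENNReal

/-! ### Time series, Page and Hankel matrices

A family of `N` time series observed over the time steps `1, …, T` is a function on
`Fin N → Fin T`; the element `t : Fin T` stands for the time step `t + 1`. -/

/-- The `⌊T/2⌋ × ⌊T/2⌋` Hankel matrix of `w(1), …, w(T)`. With indices starting at `1` its
entry `(i, j)` is `w(i + j - 1)`; with indices starting at `0` this is `w (i + j)`. -/
def hankelMatrix {T : ℕ} (w : Fin T → ℝ) : Matrix (Fin (T / 2)) (Fin (T / 2)) ℝ :=
  Matrix.of fun i j => w ⟨(i : ℕ) + (j : ℕ), by omega⟩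

/-- The time step in row `i` and column `j` of the `L × (T/L)` Page matrix, which is
`i + (j - 1) L` for indices starting at `1` and `i + j L` for indices starting at `0`. -/
def pageTime {T L : ℕ} (i : Fin L) (j : Fin (T / L)) : Fin T :=
  ⟨(i : ℕ) + (j : ℕ) * L, by
    have h1 : ((j : ℕ) + 1) * L ≤ T / L * L := Nat.mul_le_mul_right L j.isLt
    have h2 : T / L * L ≤ T := Nat.div_mul_le_self T L
    have h3 := i.isLt
    rw [Nat.add_mul] at h1
    omega⟩

/-- The stacked Page matrix `SP((x₁, …, x_N), T, L)`: the column-wise concatenation of the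
`L × (T/L)` Page matrices of the `N` series; column `(n, j)` is column `j` of the `n`-th block. -/
def stackedPage {N T : ℕ} (L : ℕ) (x : Fin N → Fin T → ℝ) :
    Matrix (Fin L) (Fin N × Fin (T / L)) ℝ :=
  Matrix.of fun i c => x c.1 (pageTime i c.2)

/-- The row `(t - 1 mod L) + 1` of the Page matrix from which time step `t` is read off. -/
def pageRow {T L : ℕ} (hLT : L ∣ T) (t : Fin T) : Fin L :=
  ⟨(t : ℕ) % L, Nat.mod_lt _ (Nat.pos_of_dvd_of_pos hLT (Fin.pos t))⟩

/-- The column `⌈t / L⌉` of the Page matrix from which time step `t` is read off. -/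
def pageCol {T L : ℕ} (hLT : L ∣ T) (t : Fin T) : Fin (T / L) :=
  ⟨(t : ℕ) / L, Nat.div_lt_div_of_lt_of_dvd hLT t.isLt⟩

/-- Reading off is inverse to forming the Page matrix. -/
theorem pageTime_pageRow_pageCol {T L : ℕ} (hLT : L ∣ T) (t : Fin T) :
    pageTime (pageRow hLT t) (pageCol hLT t) = t :=
  Fin.ext (Nat.mod_add_div' (t : ℕ) L)

/-! ### Singular values and truncated singular value decompositions -/

/-- The `k`-th largest singular value of a real matrix, `k = 1, 2, …`. -/
noncomputable def kthSingularValue {m n : Type*} [Fintype m] [Fintype n] [DecidableEq n]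
    (A : Matrix m n ℝ) (k : ℕ) : ℝ :=
  (Matrix.toEuclideanLin A).singularValues (k - 1)

/-- `B` is obtained from `A` by hard singular value thresholding with parameter `k`: for some
singular value decomposition `A = ∑ s_ℓ u_ℓ v_ℓᵀ` with `s₁ ≥ s₂ ≥ … ≥ 0`, the matrix `B` is the
sum of the first `k` terms. -/
def IsTruncatedSVD {m n : Type*} [Fintype m] [Fintype n] (k : ℕ) (A B : Matrix m n ℝ) : Prop :=
  ∃ (s : Fin (min (Fintype.card m) (Fintype.card n)) → ℝ)
    (u : Fin (min (Fintype.card m) (Fintype.card n)) → EuclideanSpace ℝ m)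
    (v : Fin (min (Fintype.card m) (Fintype.card n)) → EuclideanSpace ℝ n),
    Antitone s ∧ (∀ l, 0 ≤ s l) ∧ Orthonormal ℝ u ∧ Orthonormal ℝ v ∧
    A = ∑ l, s l • Matrix.vecMulVec (u l).ofLp (v l).ofLp ∧
    B = ∑ l : Fin (min (Fintype.card m) (Fintype.card n)),
      (if (l : ℕ) < k then s l else 0) • Matrix.vecMulVec (u l).ofLp (v l).ofLp

/-! ### The mSSA imputation algorithm -/

/-- The normalization `ρ̂ = max(1, #observed entries) / (N T)`; `none` is a missing entry. -/
noncomputable def observedFraction {N T : ℕ} (X : Fin N → Fin T → Option ℝ) : ℝ :=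
  (max 1 (Finset.univ.filter fun p : Fin N × Fin T => (X p.1 p.2).isSome).card : ℕ) /
    ((N : ℝ) * (T : ℝ))

/-- `est` is an output of the mSSA imputation algorithm with parameters `L` and `k` on the data
`X`: replace missing entries by `0`, form the stacked Page matrix, truncate its singular value
decomposition after `k` terms, divide by `ρ̂`, and read off the entries. -/
def IsMSSAEstimate {N T L : ℕ} (hLT : L ∣ T) (k : ℕ) (X : Fin N → Fin T → Option ℝ)
    (est : Fin N → Fin T → ℝ) : Prop :=
  ∃ B : Matrix (Fin L) (Fin N × Fin (T / L)) ℝ,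
    IsTruncatedSVD k (stackedPage L fun n t => (X n t).getD 0) B ∧
    ∀ n t, est n t = (observedFraction X)⁻¹ * B (pageRow hLT t) (n, pageCol hLT t)

/-! ### The model -/

/-- The spatio-temporal factor model for the `N × T` matrix with entries `x n t`: it has rank `R`
and a factorization with `R` factors whose entries are bounded by `Γ₁` and `Γ₂`, and each
temporal factor has a Hankel matrix of rank at most `G`. -/
def SpatioTemporalFactorModel {N T : ℕ} (x : Fin N → Fin T → ℝ) (R G : ℕ) (Γ₁ Γ₂ : ℝ) : Prop :=
  (Matrix.of x).rank = R ∧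
  ∃ (U : Fin N → Fin R → ℝ) (W : Fin R → Fin T → ℝ),
    (∀ n t, x n t = ∑ r, U n r * W r t) ∧
    (∀ n r, |U n r| ≤ Γ₁) ∧ (∀ r t, |W r t| ≤ Γ₂) ∧
    ∀ r, (hankelMatrix (W r)).rank ≤ G

/-- Balanced spectra: the stacked Page matrix of `x` has rank `k ≥ 1` and its `k`-th largest
singular value is at least `c √(N T) / √k`. -/
def BalancedSpectra {N T : ℕ} (L : ℕ) (x : Fin N → Fin T → ℝ) (c : ℝ) : Prop :=
  1 ≤ (stackedPage L x).rank ∧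
  c * √((N : ℝ) * (T : ℝ)) / √((stackedPage L x).rank : ℝ) ≤
    kthSingularValue (stackedPage L x) (stackedPage L x).rank

/-- The sub-gaussian norm `‖Z‖_{ψ₂} = sup_{p ≥ 1} p^{-1/2} (𝔼 |Z|^p)^{1/p}`, with values in
`[0, ∞]`. -/
noncomputable def psiTwoNorm {Ω : Type*} [MeasurableSpace Ω] (Z : Ω → ℝ) (μ : Measure Ω) : ℝ≥0∞ :=
  ⨆ (p : ℝ) (_ : 1 ≤ p), ENNReal.ofReal (p ^ (-(1 / 2) : ℝ)) * eLpNorm Z (ENNReal.ofReal p) μ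

/-- The per-step noise: independent (over all series and time steps), mean zero random variables
with sub-gaussian norm at most `γ`. -/
structure SubgaussianNoise {Ω : Type*} [MeasurableSpace Ω] (μ : Measure Ω) {N T : ℕ}
    (η : Fin N → Fin T → Ω → ℝ) (γ : ℝ) : Prop where
  measurable : ∀ n t, Measurable (η n t)
  indep : iIndepFun (fun p : Fin N × Fin T => η p.1 p.2) μ
  mean_zero : ∀ n t, ∫ ω, η n t ω ∂μ = 0
  psi_two_le : ∀ n t, psiTwoNorm (η n t) μ ≤ ENNReal.ofReal γ

/-- The time-varying variance `σ_n²(t) = 𝔼[η_n(t)²]`. -/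
noncomputable def noiseVariance {Ω : Type*} [MeasurableSpace Ω] (μ : Measure Ω) {N T : ℕ}
    (η : Fin N → Fin T → Ω → ℝ) (n : Fin N) (t : Fin T) : ℝ :=
  ∫ ω, η n t ω ^ 2 ∂μ

/-- The observations for `ρ = 1`: every entry `X_n(t) = f_n(t) + η_n(t)` is observed. -/
def observation {Ω : Type*} {N T : ℕ} (f : Fin N → Fin T → ℝ) (η : Fin N → Fin T → Ω → ℝ)
    (ω : Ω) (n : Fin N) (t : Fin T) : Option ℝ :=
  some (f n t + η n t ω)

/-- The entrywise squares `X_n²(t)` of the observations; missing entries stay missing. -/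
def squaredObservation {N T : ℕ} (X : Fin N → Fin T → Option ℝ) (n : Fin N) (t : Fin T) :
    Option ℝ :=
  (X n t).map fun x => x ^ 2

/-- The variance estimate `max(0, ĝ_n(t) - f̂_n(t)²)`. -/
noncomputable def varianceEstimate {N T : ℕ} (fhat ghat : Fin N → Fin T → ℝ) (n : Fin N)
    (t : Fin T) : ℝ :=
  max 0 (ghat n t - fhat n t ^ 2)

/-! Both runs of mSSA are hard singular value thresholding of a matrix `A = M + E`, where `M` is the
stacked Page matrix of the means and `E` has independent centered entries. If `M` has rank at most
`k`, the `k`-term truncation `B` of `A` satisfies `‖B - M‖ ≤ 2‖E‖` by Weyl's inequality. As `B - M`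
has rank at most `2k`, its squared Frobenius norm is at most `8k‖E‖²`
(`IsTruncatedSVD.sum_sq_sub_le`). Two inputs remain: the second moment of `‖E‖` and a bound on `k`.

Noise: the entries are `η` in the first run and centered squares of `f + η` in the second; in both
cases the `p`-th norm grows at most linearly in `p`. Truncating at a level of order `log(NT)` leaves
bounded entries, treated by Hoeffding's lemma and a net argument, plus a remainder whose total
variance is negligible. This yields `𝔼‖E‖² ≲ (L + NT/L) log²(NT)`
(`exists_integrable_specNorm_sq_le`), and the choice of `L` makes `(L + NT/L)/(NT)` of order
`1/√(min(N,T) T)`.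

Rank: the columns of a Page matrix, except possibly the last, are pieces of columns of the Hankel
matrix, so each temporal factor contributes rank at most `2G + 1` (`page_hasInnerDimLE`). Entrywise
squaring at most squares the rank, so the second moments `f² + σ²` also have low rank.

Finally `f̂² - f² = (f̂ + f)(f̂ - f)` with bounded first factor, so the two mean squared errors
control that of the variance estimate. Working with integrable majorants avoids any measurability
question for spectral norms and singular vectors. -/

/-- The spectral norm of a real matrix. -/
noncomputable def specNorm {m n : Type*} [Fintype m] [Fintype n] [DecidableEq n]
    (A : Matrix m n ℝ) : ℝ :=
  ‖LinearMap.toContinuousLinearMap (Matrix.toEuclideanLin A)‖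

/-! ### Spectral norm of matrices with independent sub-gaussian entries -/

/-- The closed unit ball of a `d`-dimensional space has a `1/2`-net with at most `5 ^ d`
elements. -/
theorem exists_half_net (E : Type*) [NormedAddCommGroup E] [NormedSpace ℝ E]
    [FiniteDimensional ℝ E] :
    ∃ s : Finset E, s.card ≤ 5 ^ Module.finrank ℝ E ∧ (∀ c ∈ s, ‖c‖ ≤ 1) ∧
      ∀ x : E, ‖x‖ ≤ 1 → ∃ c ∈ s, ‖x - c‖ ≤ 1 / 2 := by
  classical
  set Sep : Finset E → Prop := fun s =>
    (∀ c ∈ s, ‖c‖ ≤ 1) ∧ ∀ c ∈ s, ∀ d ∈ s, c ≠ d → 1 / 2 ≤ ‖c - d‖ with hSep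
  have hcard : ∀ s, Sep s → s.card ≤ 5 ^ Module.finrank ℝ E := by
    intro s hs
    -- Doubling turns a `1/2`-separated subset of the unit ball into a `1`-separated subset of the
    -- ball of radius `2`, the normalization of the Besicovitch cardinality bound.
    have hinj : Function.Injective fun x : E => (2 : ℝ) • x :=
      smul_right_injective E two_ne_zero
    rw [← Finset.card_image_of_injective s hinj]
    apply Besicovitch.card_le_of_separated
    · intro c hc
      obtain ⟨x, hx, rfl⟩ := Finset.mem_image.1 hc
      rw [norm_smul]
      have := hs.1 x hx
      norm_num
      linarith
    · intro c hc d hd hcd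
      obtain ⟨x, hx, rfl⟩ := Finset.mem_image.1 hc
      obtain ⟨y, hy, rfl⟩ := Finset.mem_image.1 hd
      have hxy : x ≠ y := fun h => hcd (by rw [h])
      have := hs.2 x hx y hy hxy
      rw [← smul_sub, norm_smul]
      norm_num
      linarith
  -- A separated set of maximal cardinality is a net: a point far from all its elements could be
  -- added.
  set S : Set ℕ := {k | ∃ s, Sep s ∧ s.card = k} with hS
  have hne : S.Nonempty := ⟨0, ∅, by simp [hSep], rfl⟩
  have hbdd : BddAbove S := ⟨_, by rintro k ⟨s, hs, rfl⟩; exact hcard s hs⟩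
  obtain ⟨s, hs, hsc⟩ := Nat.sSup_mem hne hbdd
  refine ⟨s, hcard s hs, hs.1, fun x hx => ?_⟩
  by_contra! hfar
  have hxs : x ∉ s := fun h => by
    have := hfar x h
    norm_num at this
  have hins : Sep (insert x s) := by
    constructor
    · intro c hc
      rcases Finset.mem_insert.1 hc with rfl | hc
      · exact hx
      · exact hs.1 c hc
    · intro c hc d hd hcd
      rcases Finset.mem_insert.1 hc with rfl | hc' <;>
        rcases Finset.mem_insert.1 hd with rfl | hd'
      · exact absurd rfl hcd
      · exact (hfar d hd').le
      · rw [norm_sub_rev]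
        exact (hfar c hc').le
      · exact hs.2 c hc' d hd' hcd
  have := le_csSup hbdd (show (insert x s).card ∈ S from ⟨_, hins, rfl⟩)
  rw [Finset.card_insert_of_notMem hxs, hsc] at this
  omega

/-- The operator norm is controlled by the bilinear form on `1/2`-nets of the unit balls. -/
theorem opNorm_le_of_half_net {E F : Type*} [NormedAddCommGroup E] [InnerProductSpace ℝ E]
    [NormedAddCommGroup F] [InnerProductSpace ℝ F] (A : E →L[ℝ] F) {s : Set E} {t : Set F}
    (hs : ∀ x : E, ‖x‖ ≤ 1 → ∃ c ∈ s, ‖x - c‖ ≤ 1 / 2)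
    (ht : ∀ x : F, ‖x‖ ≤ 1 → ∃ d ∈ t, ‖x - d‖ ≤ 1 / 2) {M : ℝ} (hM : 0 ≤ M)
    (h : ∀ c ∈ s, ∀ d ∈ t, inner ℝ d (A c) ≤ M) : ‖A‖ ≤ 4 * M := by
  have h1 : ∀ c ∈ s, ‖A c‖ ≤ 2 * M := by
    intro c hc
    rcases eq_or_ne (A c) 0 with h0 | h0
    · rw [h0, norm_zero]
      linarith
    have hpos : 0 < ‖A c‖ := norm_pos_iff.2 h0
    obtain ⟨d, hd, hdn⟩ := ht (‖A c‖⁻¹ • A c) (by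
      rw [norm_smul, norm_inv, norm_norm, inv_mul_cancel₀ hpos.ne'])
    have e1 : inner ℝ (‖A c‖⁻¹ • A c) (A c) = ‖A c‖ := by
      rw [real_inner_smul_left, real_inner_self_eq_norm_sq]
      field_simp
    have e2 : inner ℝ (‖A c‖⁻¹ • A c - d) (A c) ≤ 1 / 2 * ‖A c‖ :=
      (real_inner_le_norm _ _).trans (by gcongr)
    rw [inner_sub_left, e1] at e2
    linarith [h c hc d hd]
  have h2 : ‖A‖ ≤ 2 * M + ‖A‖ / 2 := by
    refine ContinuousLinearMap.opNorm_le_of_unit_norm (by positivity) fun x hx => ?_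
    obtain ⟨c, hc, hxc⟩ := hs x hx.le
    have : A x = A c + A (x - c) := by simp
    calc ‖A x‖ ≤ ‖A c‖ + ‖A (x - c)‖ := by
          rw [this]
          exact norm_add_le _ _
      _ ≤ 2 * M + ‖A‖ * (1 / 2) := by
          gcongr
          · exact h1 c hc
          · exact (A.le_opNorm _).trans (by gcongr)
      _ = _ := by ring
  linarith

/-- Bounds the square of a maximum by a sum of exponentials, which replaces integrating a tail
bound. Beyond `a`, `y ≤ a (1 + (y - a)/2)` because `a ≥ 2`, and `1 + x ≤ exp x` finishes. -/
theorem sq_le_sq_mul_one_add_exp {a y : ℝ} (ha : 2 ≤ a) (hy : 0 ≤ y) :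
    y ^ 2 ≤ a ^ 2 * (1 + Real.exp (y - a)) := by
  rcases le_total y a with h | h
  · nlinarith [Real.exp_pos (y - a), sq_nonneg a, mul_nonneg (sq_nonneg a) (Real.exp_pos (y - a)).le]
  · have h1 : 1 + (y - a) / 2 ≤ Real.exp ((y - a) / 2) := by
      linarith [Real.add_one_le_exp ((y - a) / 2)]
    have h2 : y ≤ a * Real.exp ((y - a) / 2) := by
      have : y ≤ a * (1 + (y - a) / 2) := by nlinarith
      exact this.trans (by gcongr)
    have h3 : Real.exp ((y - a) / 2) ^ 2 = Real.exp (y - a) := by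
      rw [← Real.exp_nat_mul]
      congr 1
      push_cast
      ring
    calc y ^ 2 ≤ (a * Real.exp ((y - a) / 2)) ^ 2 := by gcongr
      _ = a ^ 2 * Real.exp (y - a) := by rw [mul_pow, h3]
      _ ≤ _ := by nlinarith [sq_nonneg a]

theorem inner_toEuclideanLin {m n : Type*} [Fintype m] [Fintype n] [DecidableEq n]
    (A : Matrix m n ℝ) (u : EuclideanSpace ℝ m) (v : EuclideanSpace ℝ n) :
    inner ℝ u (Matrix.toEuclideanLin A v) = ∑ p : m × n, u p.1 * v p.2 * A p.1 p.2 := by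
  simp only [PiLp.inner_apply, Matrix.toLpLin_apply, Matrix.mulVec, dotProduct,
    Fintype.sum_prod_type]
  refine Finset.sum_congr rfl fun i _ => ?_
  simp only [RCLike.inner_apply, conj_trivial, Finset.sum_mul]
  exact Finset.sum_congr rfl fun j _ => by ring

/-- A bilinear form in independent sub-gaussian entries is sub-gaussian. -/
theorem mgf_bilinear_le {m n Ω : Type*} [Fintype m] [Fintype n] [MeasurableSpace Ω]
    {μ : Measure Ω} [IsProbabilityMeasure μ] {ξ : m → n → Ω → ℝ}
    (hindep : iIndepFun (fun p : m × n => ξ p.1 p.2) μ) {b : NNReal}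
    (hsub : ∀ i j, HasSubgaussianMGF (ξ i j) b μ)
    (u : EuclideanSpace ℝ m) (v : EuclideanSpace ℝ n) (hu : ‖u‖ ≤ 1) (hv : ‖v‖ ≤ 1) (t : ℝ) :
    Integrable (fun ω => Real.exp (t * ∑ p : m × n, u p.1 * v p.2 * ξ p.1 p.2 ω)) μ ∧
      ∫ ω, Real.exp (t * ∑ p : m × n, u p.1 * v p.2 * ξ p.1 p.2 ω) ∂μ ≤
        Real.exp (b * t ^ 2 / 2) := by
  have h := HasSubgaussianMGF.sum_of_iIndepFun (s := Finset.univ)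
    (X := fun p : m × n => fun ω => u p.1 * v p.2 * ξ p.1 p.2 ω)
    (c := fun p => .mk ((u p.1 * v p.2) ^ 2) (sq_nonneg _) * b)
    (hindep.comp (fun p x => u p.1 * v p.2 * x) fun p => by fun_prop)
    (fun p _ => (hsub p.1 p.2).const_mul _)
  refine ⟨h.integrable_exp_mul t, (h.mgf_le t).trans ?_⟩
  -- The variance proxies add up, and the squared weights `(u_i v_j)²` sum to `‖u‖²‖v‖² ≤ 1`.
  have hsum : ((∑ p : m × n, (.mk ((u p.1 * v p.2) ^ 2) (sq_nonneg _) * b : NNReal) : NNReal) : ℝ)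
      = ‖u‖ ^ 2 * ‖v‖ ^ 2 * b := by
    push_cast
    rw [← Finset.sum_mul, EuclideanSpace.norm_sq_eq, EuclideanSpace.norm_sq_eq,
      Finset.sum_mul_sum, Fintype.sum_prod_type]
    congr 1
    refine Finset.sum_congr rfl fun i _ => Finset.sum_congr rfl fun j _ => ?_
    simp [mul_pow]
  rw [hsum]
  apply Real.exp_le_exp.2
  have h1 : ‖u‖ ^ 2 ≤ 1 := pow_le_one₀ (norm_nonneg _) hu
  have h2 : ‖v‖ ^ 2 ≤ 1 := pow_le_one₀ (norm_nonneg _) hv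
  have h3 : ‖u‖ ^ 2 * ‖v‖ ^ 2 ≤ 1 := mul_le_one₀ h1 (sq_nonneg _) h2
  have : ‖u‖ ^ 2 * ‖v‖ ^ 2 * (b : ℝ) ≤ 1 * b := by gcongr
  have ht := sq_nonneg t
  nlinarith

/-- The second moment of the spectral norm of a random matrix with independent sub-gaussian
entries, in the form of an integrable upper bound. -/
theorem exists_integrable_specNorm_sq_le_of_hasSubgaussianMGF {m n Ω : Type*} [Fintype m]
    [Fintype n] [DecidableEq n] [Nonempty m] [Nonempty n] [MeasurableSpace Ω]
    {μ : Measure Ω} [IsProbabilityMeasure μ] {ξ : m → n → Ω → ℝ}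
    (hindep : iIndepFun (fun p : m × n => ξ p.1 p.2) μ) {B : NNReal} (hB : 0 < B)
    (hsub : ∀ i j, HasSubgaussianMGF (ξ i j) (B ^ 2) μ) :
    ∃ H : Ω → ℝ, Integrable H μ ∧
      (∀ ω, specNorm (Matrix.of fun i j => ξ i j ω) ^ 2 ≤ H ω) ∧
      ∫ ω, H ω ∂μ ≤ 288 * ((Fintype.card m : ℝ) + Fintype.card n) * B ^ 2 := by
  obtain ⟨s, hsc, hs1, hs⟩ := exists_half_net (EuclideanSpace ℝ n)
  obtain ⟨r, hrc, hr1, hr⟩ := exists_half_net (EuclideanSpace ℝ m)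
  rw [finrank_euclideanSpace] at hsc hrc
  set N : ℝ := (Fintype.card m : ℝ) + Fintype.card n with hN
  have hm1 : (1 : ℝ) ≤ Fintype.card m := by exact_mod_cast Fintype.card_pos
  have hn1 : (1 : ℝ) ≤ Fintype.card n := by exact_mod_cast Fintype.card_pos
  have hN2 : 2 ≤ N := by linarith
  have hBpos : (0 : ℝ) < B := hB
  -- With `t² B² = N` each net pair contributes at most `exp(N/2)`. There are at most `5 ^ N` pairs
  -- and `5 ≤ exp(5/2)`, so `a = 3N` exactly absorbs the union bound. The constant `288` is `4² · 9
  -- · 2`, from the net, `(a/t)² = 9NB²` and `1 + 1`.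
  set a : ℝ := 3 * N with ha
  set t : ℝ := √N / B with ht
  have htpos : 0 < t := div_pos (Real.sqrt_pos.2 (by linarith)) hBpos
  have ht2 : t ^ 2 = N / (B : ℝ) ^ 2 := by
    rw [ht, div_pow, Real.sq_sqrt (by linarith)]
  set Z : EuclideanSpace ℝ m → EuclideanSpace ℝ n → Ω → ℝ := fun d c ω =>
    ∑ p : m × n, d p.1 * c p.2 * ξ p.1 p.2 ω with hZ
  set S : Ω → ℝ := fun ω => ∑ d ∈ r, ∑ c ∈ s, Real.exp (t * Z d c ω) with hS
  have hSi : Integrable S μ := by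
    refine integrable_finsetSum _ fun d hd => integrable_finsetSum _ fun c hc => ?_
    exact (mgf_bilinear_le hindep hsub d c (hr1 d hd) (hs1 c hc) t).1
  have hSb : ∫ ω, S ω ∂μ ≤ 5 ^ N * Real.exp (N / 2) := by
    rw [hS, integral_finsetSum _ fun d hd => integrable_finsetSum _ fun c hc =>
      (mgf_bilinear_le hindep hsub d c (hr1 d hd) (hs1 c hc) t).1]
    have e : ∀ d ∈ r, ∫ ω, ∑ c ∈ s, Real.exp (t * Z d c ω) ∂μ ≤ s.card * Real.exp (N / 2) := by
      intro d hd
      rw [integral_finsetSum _ fun c hc =>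
        (mgf_bilinear_le hindep hsub d c (hr1 d hd) (hs1 c hc) t).1, ← nsmul_eq_mul]
      refine Finset.sum_le_card_nsmul _ _ _ fun c hc => ?_
      refine (mgf_bilinear_le hindep hsub d c (hr1 d hd) (hs1 c hc) t).2.trans_eq ?_
      rw [ht2]
      congr 1
      push_cast
      field_simp
    refine (Finset.sum_le_card_nsmul _ _ _ e).trans ?_
    rw [nsmul_eq_mul, ← mul_assoc]
    gcongr
    rw [hN, Real.rpow_add (by norm_num), Real.rpow_natCast, Real.rpow_natCast]
    gcongr
    · exact_mod_cast hrc
    · exact_mod_cast hsc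
  have hfive : (5 : ℝ) ^ N * Real.exp (N / 2) * Real.exp (-a) ≤ 1 := by
    have h5 : (5 : ℝ) ≤ Real.exp (5 / 2) := by
      have h1 := Real.quadratic_le_exp_of_nonneg (x := 5 / 2) (by norm_num)
      norm_num at h1
      linarith
    calc (5 : ℝ) ^ N * Real.exp (N / 2) * Real.exp (-a)
        ≤ Real.exp (5 / 2) ^ N * Real.exp (N / 2) * Real.exp (-a) := by gcongr
      _ = 1 := by
        rw [← Real.exp_mul, ← Real.exp_add, ← Real.exp_add, Real.exp_eq_one_iff]
        ring
  have hSnn : ∀ ω, 0 ≤ S ω := fun ω =>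
    Finset.sum_nonneg fun d _ => Finset.sum_nonneg fun c _ => (Real.exp_pos _).le
  refine ⟨fun ω => 16 * ((a / t) ^ 2 * (1 + Real.exp (-a) * S ω)),
    (((integrable_const 1).add (hSi.const_mul _)).const_mul _).const_mul _, fun ω => ?_, ?_⟩
  · have hy : 0 ≤ (a / t) ^ 2 * (1 + Real.exp (-a) * S ω) := by
      have := hSnn ω
      positivity
    have key := opNorm_le_of_half_net
      (LinearMap.toContinuousLinearMap (Matrix.toEuclideanLin (Matrix.of fun i j => ξ i j ω)))
      (s := (s : Set _)) (t := (r : Set _)) hs hr (Real.sqrt_nonneg _)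
      (M := √((a / t) ^ 2 * (1 + Real.exp (-a) * S ω))) (by
        intro c hc d hd
        have e : inner ℝ d ((LinearMap.toContinuousLinearMap
            (Matrix.toEuclideanLin (Matrix.of fun i j => ξ i j ω))) c) = Z d c ω :=
          inner_toEuclideanLin _ d c
        rw [e]
        rcases le_total (Z d c ω) 0 with hz | hz
        · exact hz.trans (Real.sqrt_nonneg _)
        apply Real.le_sqrt_of_sq_le
        have h1 := sq_le_sq_mul_one_add_exp (a := a) (by linarith) (mul_nonneg htpos.le hz)
        have h2 : Real.exp (t * Z d c ω - a) ≤ Real.exp (-a) * S ω := by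
          rw [sub_eq_neg_add, Real.exp_add]
          gcongr
          calc Real.exp (t * Z d c ω) ≤ ∑ c ∈ s, Real.exp (t * Z d c ω) :=
                Finset.single_le_sum (f := fun c => Real.exp (t * Z d c ω))
                  (fun c _ => (Real.exp_pos _).le) hc
            _ ≤ S ω := Finset.single_le_sum (f := fun d => ∑ c ∈ s, Real.exp (t * Z d c ω))
                  (fun d _ => Finset.sum_nonneg fun c _ => (Real.exp_pos _).le) hd
        have h3 : (t * Z d c ω) ^ 2 ≤ a ^ 2 * (1 + Real.exp (-a) * S ω) :=
          h1.trans (by gcongr)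
        rw [div_pow, div_mul_eq_mul_div, le_div_iff₀ (by positivity)]
        linarith [mul_pow t (Z d c ω) 2])
    calc specNorm (Matrix.of fun i j => ξ i j ω) ^ 2
        ≤ (4 * √((a / t) ^ 2 * (1 + Real.exp (-a) * S ω))) ^ 2 := by
          have h0 : 0 ≤ specNorm (Matrix.of fun i j => ξ i j ω) := norm_nonneg _
          gcongr
          exact key
      _ = _ := by
          rw [mul_pow, Real.sq_sqrt hy]
          norm_num
  · rw [integral_const_mul, integral_const_mul,
      integral_add (integrable_const _) (hSi.const_mul _), integral_const_mul]
    have h1 : Real.exp (-a) * ∫ ω, S ω ∂μ ≤ 1 := by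
      refine le_trans ?_ hfive
      rw [mul_comm]
      gcongr
    have h2 : (a / t) ^ 2 = 9 * N * (B : ℝ) ^ 2 := by
      rw [div_pow, ht2, ha]
      have : N ≠ 0 := by linarith
      field_simp
      ring
    rw [h2]
    simp only [integral_const, probReal_univ, smul_eq_mul, mul_one]
    have : 0 ≤ 9 * N * (B : ℝ) ^ 2 := by positivity
    nlinarith

/-! ### Truncation: from sub-gaussian to sub-exponential entries -/

theorem specNorm_nonneg {m n : Type*} [Fintype m] [Fintype n] [DecidableEq n]
    (A : Matrix m n ℝ) : 0 ≤ specNorm A := norm_nonneg _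

theorem specNorm_add_le {m n : Type*} [Fintype m] [Fintype n] [DecidableEq n]
    (A B : Matrix m n ℝ) : specNorm (A + B) ≤ specNorm A + specNorm B := by
  unfold specNorm
  rw [map_add, map_add]
  exact norm_add_le _ _

theorem norm_toEuclideanLin_le {m n : Type*} [Fintype m] [Fintype n] [DecidableEq n]
    (A : Matrix m n ℝ) (x : EuclideanSpace ℝ n) :
    ‖Matrix.toEuclideanLin A x‖ ≤ specNorm A * ‖x‖ :=
  (LinearMap.toContinuousLinearMap (Matrix.toEuclideanLin A)).le_opNorm x

theorem specNorm_sq_le_sum_sq {m n : Type*} [Fintype m] [Fintype n] [DecidableEq n]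
    (A : Matrix m n ℝ) : specNorm A ^ 2 ≤ ∑ i, ∑ j, A i j ^ 2 := by
  have h0 : 0 ≤ ∑ i, ∑ j, A i j ^ 2 :=
    Finset.sum_nonneg fun i _ => Finset.sum_nonneg fun j _ => sq_nonneg _
  have h : specNorm A ≤ √(∑ i, ∑ j, A i j ^ 2) := by
    refine ContinuousLinearMap.opNorm_le_bound _ (Real.sqrt_nonneg _) fun x => ?_
    refine le_of_sq_le_sq ?_ (by positivity)
    rw [mul_pow, Real.sq_sqrt h0, EuclideanSpace.real_norm_sq_eq, EuclideanSpace.real_norm_sq_eq,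
      Finset.sum_mul]
    refine Finset.sum_le_sum fun i _ => ?_
    exact Finset.sum_mul_sq_le_sq_mul_sq _ _ _
  calc specNorm A ^ 2 ≤ √(∑ i, ∑ j, A i j ^ 2) ^ 2 :=
        pow_le_pow_left₀ (specNorm_nonneg A) h 2
    _ = _ := Real.sq_sqrt h0

theorem integral_abs_pow_le_of_eLpNorm_le {Ω : Type*} [MeasurableSpace Ω] {μ : Measure Ω}
    {X : Ω → ℝ} (hX : Measurable X) {p : ℕ} (hp : p ≠ 0) {M : ℝ} (hM : 0 ≤ M)
    (h : eLpNorm X p μ ≤ ENNReal.ofReal M) :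
    Integrable (fun ω => |X ω| ^ p) μ ∧ ∫ ω, |X ω| ^ p ∂μ ≤ M ^ p := by
  have hmem : MemLp X p μ := ⟨hX.aestronglyMeasurable, h.trans_lt ENNReal.ofReal_lt_top⟩
  have hp0 : (p : ℝ≥0∞) ≠ 0 := by exact_mod_cast hp
  refine ⟨by simpa using hmem.integrable_norm_pow hp, ?_⟩
  rw [hmem.eLpNorm_eq_integral_rpow_norm hp0 (ENNReal.natCast_ne_top p),
    ENNReal.ofReal_le_ofReal_iff hM] at h
  simp only [ENNReal.toReal_natCast, Real.rpow_natCast, Real.norm_eq_abs] at h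
  have hI : 0 ≤ ∫ ω, |X ω| ^ p ∂μ := integral_nonneg fun ω => by positivity
  calc ∫ ω, |X ω| ^ p ∂μ = ((∫ ω, |X ω| ^ p ∂μ) ^ (p : ℝ)⁻¹) ^ p :=
        (Real.rpow_inv_natCast_pow hI hp).symm
    _ ≤ M ^ p := by gcongr

/-- Truncation of a real number to zero outside `[-B, B]`. -/
noncomputable def truncate (B x : ℝ) : ℝ := if |x| ≤ B then x else 0

theorem measurable_truncate (B : ℝ) : Measurable (truncate B) :=
  Measurable.ite (measurableSet_le (by fun_prop) (by fun_prop)) measurable_id measurable_const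

theorem abs_truncate_le {B : ℝ} (hB : 0 ≤ B) (x : ℝ) : |truncate B x| ≤ B := by
  unfold truncate
  split_ifs with h
  · exact h
  · simpa

theorem sq_sub_truncate_le {B : ℝ} (hB : 0 < B) (x : ℝ) {p : ℕ} (hp : 2 ≤ p) :
    (x - truncate B x) ^ 2 ≤ |x| ^ p * (B ^ 2 / B ^ p) := by
  unfold truncate
  split_ifs with h
  · rw [sub_self, zero_pow two_ne_zero]
    positivity
  · obtain ⟨k, rfl⟩ := Nat.exists_eq_add_of_le hp
    rw [sub_zero, pow_add, pow_add, sq_abs, ← div_div, div_self (by positivity), mul_assoc,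
      mul_one_div]
    have h1 : 1 ≤ |x| ^ k / B ^ k := by
      rw [le_div_iff₀ (by positivity), one_mul]
      gcongr
      exact (not_le.1 h).le
    nlinarith [sq_nonneg x]

/-- The part of a centered random variable outside a large interval has small variance. -/
theorem integral_sq_truncate_remainder_le {Ω : Type*} [MeasurableSpace Ω] {μ : Measure Ω}
    [IsProbabilityMeasure μ] {X : Ω → ℝ} (hX : Measurable X) (h0 : ∫ ω, X ω ∂μ = 0) {p : ℕ}
    (hp : 2 ≤ p) {M : ℝ} (hM : 0 < M) (h : eLpNorm X p μ ≤ ENNReal.ofReal M) {B : ℝ}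
    (hB : B = Real.exp 1 * M) :
    Integrable (fun ω => (X ω - (truncate B (X ω) - ∫ ω, truncate B (X ω) ∂μ)) ^ 2) μ ∧
      ∫ ω, (X ω - (truncate B (X ω) - ∫ ω, truncate B (X ω) ∂μ)) ^ 2 ∂μ ≤
        B ^ 2 * Real.exp (-p) := by
  have hBpos : 0 < B := by rw [hB]; positivity
  obtain ⟨hi, hle⟩ := integral_abs_pow_le_of_eLpNorm_le hX (by omega) hM.le h
  have hmem : MemLp X p μ := ⟨hX.aestronglyMeasurable, h.trans_lt ENNReal.ofReal_lt_top⟩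
  have hmem2 : MemLp X 2 μ := hmem.mono_exponent (by exact_mod_cast hp)
  have htm : Measurable fun ω => truncate B (X ω) := (measurable_truncate B).comp hX
  have htmem : MemLp (fun ω => truncate B (X ω)) 2 μ :=
    MemLp.of_bound htm.aestronglyMeasurable B
      (Filter.Eventually.of_forall fun ω => abs_truncate_le hBpos.le _)
  set W : Ω → ℝ := fun ω => X ω - truncate B (X ω) with hW
  have hWmem : MemLp W 2 μ := hmem2.sub htmem
  -- Since `X` is centered, the remainder is `W - 𝔼 W`, so its second moment is a variance, at most
  -- `𝔼 W²`.
  have hmean : ∫ ω, W ω ∂μ = -∫ ω, truncate B (X ω) ∂μ := by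
    rw [hW, integral_sub (hmem2.integrable one_le_two) (htmem.integrable one_le_two), h0, zero_sub]
  have heq : (fun ω => (X ω - (truncate B (X ω) - ∫ ω, truncate B (X ω) ∂μ)) ^ 2) =
      fun ω => (W ω - ∫ ω, W ω ∂μ) ^ 2 := by
    funext ω
    rw [hmean]
    simp only [hW]
    ring
  rw [heq]
  refine ⟨(hWmem.sub (memLp_const _)).integrable_sq, ?_⟩
  rw [← variance_eq_integral hWmem.aemeasurable]
  refine (variance_le_expectation_sq hWmem.aestronglyMeasurable).trans ?_
  calc ∫ ω, (W ^ 2) ω ∂μ ≤ ∫ ω, |X ω| ^ p * (B ^ 2 / B ^ p) ∂μ :=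
        integral_mono hWmem.integrable_sq (hi.mul_const _) fun ω => sq_sub_truncate_le hBpos _ hp
    _ = (∫ ω, |X ω| ^ p ∂μ) * (B ^ 2 / B ^ p) := integral_mul_const _ _
    _ ≤ M ^ p * (B ^ 2 / B ^ p) := by gcongr
    _ = B ^ 2 * Real.exp (-p) := by
      have e : Real.exp (-p) = (Real.exp 1 ^ p)⁻¹ := by
        rw [Real.exp_neg, ← Real.exp_nat_mul, mul_one]
      rw [e, hB, mul_pow _ _ p]
      field_simp

/-- The second moment of the spectral norm of a random matrix with independent, centered,
sub-exponential entries, in the form of an integrable upper bound. -/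
theorem exists_integrable_specNorm_sq_le {m n Ω : Type*} [Fintype m] [Fintype n] [DecidableEq n]
    [MeasurableSpace Ω] {μ : Measure Ω} [IsProbabilityMeasure μ] {ξ : m → n → Ω → ℝ}
    (hmn : 2 ≤ Fintype.card m * Fintype.card n) (hmeas : ∀ i j, Measurable (ξ i j))
    (hindep : iIndepFun (fun p : m × n => ξ p.1 p.2) μ) (hmean : ∀ i j, ∫ ω, ξ i j ω ∂μ = 0)
    {K : ℝ} (hK : 0 < K)
    (hmom : ∀ i j, ∀ p : ℕ, 1 ≤ p → eLpNorm (ξ i j) p μ ≤ ENNReal.ofReal (K * p)) :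
    ∃ H : Ω → ℝ, Integrable H μ ∧
      (∀ ω, specNorm (Matrix.of fun i j => ξ i j ω) ^ 2 ≤ H ω) ∧
      ∫ ω, H ω ∂μ ≤ 90000 * ((Fintype.card m : ℝ) + Fintype.card n) * K ^ 2 *
        Real.log ((Fintype.card m : ℝ) * Fintype.card n) ^ 2 := by
  have hm : 0 < Fintype.card m := Nat.pos_of_ne_zero fun h => by simp [h] at hmn
  have hn : 0 < Fintype.card n := Nat.pos_of_ne_zero fun h => by simp [h] at hmn
  have : Nonempty m := Fintype.card_pos_iff.1 hm
  have : Nonempty n := Fintype.card_pos_iff.1 hn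
  set D : ℝ := (Fintype.card m : ℝ) * Fintype.card n with hD
  have hD2 : 2 ≤ D := by rw [hD]; exact_mod_cast hmn
  have hlog : 0.6931 < Real.log D := by
    have := Real.log_le_log (by norm_num) hD2
    linarith [Real.log_two_gt_d9]
  -- `p ≥ log D` makes the `D` remainders, each of second moment at most `B² exp(-p)`, sum to at
  -- most `B²`. As `D ≥ 2`, also `p ≤ 4 log D`, so `B = e K p` is of order `K log D`: this is the
  -- source of the `log²` factor.
  set p : ℕ := ⌈Real.log D⌉₊ + 1 with hp
  have hp2 : 2 ≤ p := by
    have : 0 < ⌈Real.log D⌉₊ := Nat.ceil_pos.2 (by linarith)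
    omega
  have hpl : Real.log D ≤ p := by
    rw [hp]
    push_cast
    linarith [Nat.le_ceil (Real.log D)]
  have hpu : (p : ℝ) ≤ 4 * Real.log D := by
    rw [hp]
    push_cast
    linarith [Nat.ceil_lt_add_one (show 0 ≤ Real.log D by linarith)]
  have hp0 : (0 : ℝ) < p := by linarith
  set B : ℝ := Real.exp 1 * (K * p) with hB
  have hBpos : 0 < B := by positivity
  set τ : m → n → Ω → ℝ := fun i j ω => truncate B (ξ i j ω) - ∫ ω, truncate B (ξ i j ω) ∂μ
    with hτ
  have hrem := fun i j => integral_sq_truncate_remainder_le (hmeas i j) (hmean i j) hp2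
    (by positivity) (hmom i j p (by omega)) hB
  obtain ⟨H, hHi, hH, hHle⟩ := exists_integrable_specNorm_sq_le_of_hasSubgaussianMGF
    (ξ := τ) (μ := μ) (B := .mk B hBpos.le)
    (hindep.comp (fun p x => truncate B x - ∫ ω, truncate B (ξ p.1 p.2 ω) ∂μ)
      fun p => (measurable_truncate B).sub_const _) hBpos (fun i j => by
        -- Hoeffding's lemma: a centered variable with values in an interval of length `2B` has
        -- variance proxy `B²`.
        have h := hasSubgaussianMGF_of_mem_Icc (μ := μ) (a := -B) (b := B)
          ((measurable_truncate B).comp (hmeas i j)).aemeasurable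
          (Filter.Eventually.of_forall fun ω => abs_le.1 (abs_truncate_le hBpos.le (ξ i j ω)))
        have e : (‖B - -B‖₊ / 2 : NNReal) = .mk B hBpos.le := by
          apply NNReal.eq
          rw [NNReal.coe_div, coe_nnnorm, Real.norm_eq_abs, NNReal.coe_ofNat,
            abs_of_pos (by linarith), NNReal.coe_mk]
          ring
        rwa [e] at h)
  refine ⟨fun ω => 2 * H ω + 2 * ∑ i, ∑ j, (ξ i j ω - τ i j ω) ^ 2, ?_, fun ω => ?_, ?_⟩
  · exact (hHi.const_mul 2).add (Integrable.const_mul (integrable_finsetSum _ fun i _ =>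
      integrable_finsetSum _ fun j _ => (hrem i j).1) 2)
  · have e : (Matrix.of fun i j => ξ i j ω) = (Matrix.of fun i j => τ i j ω) +
        Matrix.of fun i j => ξ i j ω - τ i j ω := by
      ext i j
      simp
    have h1 := specNorm_add_le (Matrix.of fun i j => τ i j ω)
      (Matrix.of fun i j => ξ i j ω - τ i j ω)
    rw [← e] at h1
    have h2 := specNorm_sq_le_sum_sq (Matrix.of fun i j => ξ i j ω - τ i j ω)
    simp only [Matrix.of_apply] at h2
    have h3 := hH ω
    have h4 := specNorm_nonneg (Matrix.of fun i j => ξ i j ω)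
    nlinarith [sq_nonneg (specNorm (Matrix.of fun i j => τ i j ω) -
      specNorm (Matrix.of fun i j => ξ i j ω - τ i j ω))]
  · rw [integral_add (hHi.const_mul 2) (Integrable.const_mul (integrable_finsetSum _ fun i _ =>
      integrable_finsetSum _ fun j _ => (hrem i j).1) 2), integral_const_mul, integral_const_mul,
      integral_finsetSum _ fun i _ => integrable_finsetSum _ fun j _ => (hrem i j).1]
    have hsum : ∑ i, ∫ ω, ∑ j, (ξ i j ω - τ i j ω) ^ 2 ∂μ ≤ B ^ 2 := by
      calc ∑ i, ∫ ω, ∑ j, (ξ i j ω - τ i j ω) ^ 2 ∂μ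
          = ∑ i, ∑ j, ∫ ω, (ξ i j ω - τ i j ω) ^ 2 ∂μ :=
            Finset.sum_congr rfl fun i _ => integral_finsetSum _ fun j _ => (hrem i j).1
        _ ≤ ∑ i : m, ∑ j : n, B ^ 2 * Real.exp (-p) :=
            Finset.sum_le_sum fun i _ => Finset.sum_le_sum fun j _ => (hrem i j).2
        _ = B ^ 2 * (D * Real.exp (-p)) := by
            simp only [Finset.sum_const, Finset.card_univ, nsmul_eq_mul, hD]
            ring
        _ ≤ B ^ 2 * 1 := by
            gcongr
            rw [Real.exp_neg, ← div_eq_mul_inv, div_le_one (Real.exp_pos _)]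
            calc D = Real.exp (Real.log D) := (Real.exp_log (by linarith)).symm
              _ ≤ _ := Real.exp_le_exp.2 hpl
        _ = _ := mul_one _
    have hB2 : B ^ 2 ≤ 144 * (K ^ 2 * Real.log D ^ 2) := by
      have : B ≤ 12 * (K * Real.log D) := by
        calc B ≤ 3 * (K * (4 * Real.log D)) := by
              rw [hB]
              gcongr
              linarith [Real.exp_one_lt_d9]
          _ = _ := by ring
      calc B ^ 2 ≤ (12 * (K * Real.log D)) ^ 2 := by gcongr
        _ = _ := by ring
    have hN : 2 ≤ (Fintype.card m : ℝ) + Fintype.card n := by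
      have hm1 : (1 : ℝ) ≤ Fintype.card m := by exact_mod_cast hm
      have hn1 : (1 : ℝ) ≤ Fintype.card n := by exact_mod_cast hn
      linarith
    set N : ℝ := (Fintype.card m : ℝ) + Fintype.card n
    have hHle' : ∫ ω, H ω ∂μ ≤ 288 * N * B ^ 2 := hHle
    have h1 : 2 * (288 * N * B ^ 2) + 2 * B ^ 2 ≤ 577 * N * B ^ 2 := by nlinarith [sq_nonneg B]
    have h2 : 577 * N * B ^ 2 ≤ 577 * N * (144 * (K ^ 2 * Real.log D ^ 2)) := by gcongr
    have h3 : 0 ≤ N * (K ^ 2 * Real.log D ^ 2) := by positivity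
    linarith

/-! ### Low rank of stacked Page matrices -/

/-- `A` is a product of two matrices with inner dimension at most `r`. -/
def HasInnerDimLE {m n : Type*} (A : Matrix m n ℝ) (r : ℕ) : Prop :=
  ∃ (ι : Type) (_ : Fintype ι) (X : m → ι → ℝ) (Y : ι → n → ℝ),
    Fintype.card ι ≤ r ∧ ∀ i j, A i j = ∑ l, X i l * Y l j

namespace HasInnerDimLE

variable {m n : Type*} {A B : Matrix m n ℝ} {r s : ℕ}

theorem rank_le [Fintype n] (h : HasInnerDimLE A r) : A.rank ≤ r := by
  obtain ⟨ι, _, X, Y, hc, h⟩ := h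
  have e : A = Matrix.of X * Matrix.of Y := by
    ext i j
    simpa [Matrix.mul_apply] using h i j
  rw [e]
  exact (Matrix.rank_mul_le_left _ _).trans ((Matrix.rank_le_card_width _).trans hc)

theorem of_rank_le [Finite m] [Fintype n] (h : A.rank ≤ r) : HasInnerDimLE A r := by
  rw [Matrix.rank_eq_finrank_span_cols] at h
  set V := Submodule.span ℝ (Set.range A.col)
  have hmem : ∀ j, A.col j ∈ V := fun j => Submodule.subset_span ⟨j, rfl⟩
  have : Module.Finite ℝ V := inferInstance
  let b := Module.finBasis ℝ V
  refine ⟨Fin (Module.finrank ℝ V), inferInstance, fun i l => (b l : m → ℝ) i,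
    fun l j => b.repr ⟨A.col j, hmem j⟩ l, by simpa using h, fun i j => ?_⟩
  have e := congrArg (fun v : V => (v : m → ℝ) i) (b.sum_repr ⟨A.col j, hmem j⟩)
  simp only [Submodule.coe_sum, Submodule.coe_smul, Finset.sum_apply, Pi.smul_apply,
    smul_eq_mul] at e
  rw [show A i j = A.col j i from rfl, ← e]
  exact Finset.sum_congr rfl fun l _ => mul_comm _ _

theorem add (hA : HasInnerDimLE A r) (hB : HasInnerDimLE B s) :
    HasInnerDimLE (A + B) (r + s) := by
  obtain ⟨ι, _, X, Y, hc, hA⟩ := hA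
  obtain ⟨κ, _, X', Y', hc', hB⟩ := hB
  refine ⟨ι ⊕ κ, inferInstance, fun i => Sum.elim (X i) (X' i),
    fun l j => Sum.elim (fun l => Y l j) (fun l => Y' l j) l, ?_, fun i j => ?_⟩
  · rw [Fintype.card_sum]
    omega
  · simp [hA, hB]

/-- Multiplying the two expansions entrywise gives a sum indexed by pairs of summands. -/
theorem hadamard (hA : HasInnerDimLE A r) (hB : HasInnerDimLE B s) :
    HasInnerDimLE (Matrix.of fun i j => A i j * B i j) (r * s) := by
  obtain ⟨ι, _, X, Y, hc, hA⟩ := hA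
  obtain ⟨κ, _, X', Y', hc', hB⟩ := hB
  refine ⟨ι × κ, inferInstance, fun i l => X i l.1 * X' i l.2, fun l j => Y l.1 j * Y' l.2 j,
    ?_, fun i j => ?_⟩
  · rw [Fintype.card_prod]
    exact Nat.mul_le_mul hc hc'
  · rw [Matrix.of_apply, hA, hB, Finset.sum_mul_sum, Fintype.sum_prod_type]
    exact Finset.sum_congr rfl fun i _ => Finset.sum_congr rfl fun j _ => by ring

theorem of_submatrix_mul {m' n' : Type*} (hA : HasInnerDimLE A r) (f : m' → m) (g : n' → n)
    (w : n' → ℝ) : HasInnerDimLE (Matrix.of fun i j => A (f i) (g j) * w j) r := by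
  obtain ⟨ι, _, X, Y, hc, hA⟩ := hA
  refine ⟨ι, inferInstance, fun i l => X (f i) l, fun l j => Y l (g j) * w j, hc, fun i j => ?_⟩
  rw [Matrix.of_apply, hA, Finset.sum_mul]
  exact Finset.sum_congr rfl fun l _ => by ring

theorem vecMulVec (u : m → ℝ) (v : n → ℝ) : HasInnerDimLE (Matrix.of fun i j => u i * v j) 1 :=
  ⟨Unit, inferInstance, fun i _ => u i, fun _ j => v j, by simp, by simp⟩

theorem sum {R : ℕ} {C : Fin R → Matrix m n ℝ} (h : ∀ k, HasInnerDimLE (C k) r) :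
    HasInnerDimLE (∑ k, C k) (R * r) := by
  induction R with
  | zero => exact ⟨Empty, inferInstance, fun _ _ => 0, fun _ _ => 0, by simp, by simp⟩
  | succ R ih =>
    rw [Fin.sum_univ_castSucc, Nat.succ_mul]
    exact (ih fun k => h k.castSucc).add (h (Fin.last R))

end HasInnerDimLE

/-- The Page matrix of a series inherits the low rank of its Hankel matrix. -/
theorem page_hasInnerDimLE {T L G : ℕ} (hLT : L ∣ T) (w : Fin T → ℝ)
    (hG : (hankelMatrix w).rank ≤ G) :
    HasInnerDimLE (Matrix.of fun (i : Fin L) (j : Fin (T / L)) => w (pageTime i j))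
      (2 * G + 1) := by
  rcases Nat.eq_zero_or_pos T with rfl | hT
  · exact (HasInnerDimLE.of_rank_le ((Matrix.rank_le_width _).trans (by simp)))
  have hL : 0 < L := Nat.pos_of_dvd_of_pos hLT hT
  -- With fewer than two rows or columns the rank is at most `1`. Below, `q ≥ 2` gives `L ≤ h`, and
  -- `L ≥ 2` ensures that the Hankel matrix reaches the end of the last column but one.
  rcases Nat.lt_or_ge L 2 with hL2 | hL2
  · exact HasInnerDimLE.of_rank_le ((Matrix.rank_le_height _).trans (by omega))
  obtain ⟨q, rfl⟩ := hLT
  have hq : L * q / L = q := Nat.mul_div_cancel_left q hL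
  rcases Nat.lt_or_ge q 2 with hq2 | hq2
  · exact HasInnerDimLE.of_rank_le ((Matrix.rank_le_width _).trans (by omega))
  have h2L : 2 * L ≤ L * q := by
    rw [mul_comm 2]
    exact Nat.mul_le_mul_left L hq2
  set h := L * q / 2 with hh
  have hLh : L ≤ h := by omega
  have hH : HasInnerDimLE (hankelMatrix w) G := HasInnerDimLE.of_rank_le hG
  -- Page columns starting before `h` lie in the top `L` Hankel rows, later ones in the bottom `L`
  -- rows. The last column may run past the final Hankel entry `w (2h - 2)`, hence a separate
  -- rank-one term. The `min` only keeps indices in range; where it would alter a needed index, the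
  -- column weight is `0`.
  have key := ((hH.of_submatrix_mul (fun i : Fin L => (⟨i, by omega⟩ : Fin (L * q / 2)))
      (fun j : Fin (L * q / L) => (⟨min (j * L) (h - 1), by omega⟩ : Fin (L * q / 2)))
      (fun j => if (j : ℕ) * L < h then 1 else 0)).add
    (hH.of_submatrix_mul (fun i : Fin L => (⟨i + (h - L), by omega⟩ : Fin (L * q / 2)))
      (fun j : Fin (L * q / L) => (⟨min (j * L - (h - L)) (h - 1), by omega⟩ : Fin (L * q / 2)))
      (fun j => if (j : ℕ) * L < h then 0 else if (j : ℕ) + 1 = q then 0 else 1))).add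
    (HasInnerDimLE.vecMulVec
      (fun i : Fin L => w (pageTime i (⟨q - 1, by omega⟩ : Fin (L * q / L))))
      (fun j : Fin (L * q / L) =>
        if (j : ℕ) * L < h then (0 : ℝ) else if (j : ℕ) + 1 = q then 1 else 0))
  rw [← two_mul] at key
  convert key using 1
  ext i j
  have hi := i.isLt
  have hj : (j : ℕ) < q := by
    have := j.isLt
    omega
  simp only [Matrix.add_apply, Matrix.of_apply, hankelMatrix]
  split_ifs with h1 h2
  · simp only [mul_one, mul_zero, add_zero]
    congr 1
    apply Fin.ext
    simp only [pageTime]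
    omega
  · simp only [mul_one, mul_zero, zero_add]
    congr 2
    apply Fin.ext
    simp only
    omega
  · simp only [mul_one, mul_zero, add_zero, zero_add]
    congr 1
    apply Fin.ext
    simp only [pageTime]
    have h3 : ((j : ℕ) + 2) * L ≤ q * L := Nat.mul_le_mul_right L (by omega)
    rw [Nat.add_mul, mul_comm q L] at h3
    omega

/-- For each factor all `N` blocks are multiples of one Page matrix; the loadings enter as column
weights, so stacking does not raise the rank. -/
theorem SpatioTemporalFactorModel.stackedPage_hasInnerDimLE {N T L R G : ℕ} (hLT : L ∣ T)
    {x : Fin N → Fin T → ℝ} {Γ₁ Γ₂ : ℝ} (h : SpatioTemporalFactorModel x R G Γ₁ Γ₂) :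
    HasInnerDimLE (stackedPage L x) (R * (2 * G + 1)) := by
  obtain ⟨-, U, W, hx, -, -, hG⟩ := h
  have key := HasInnerDimLE.sum fun r =>
    (page_hasInnerDimLE hLT (W r) (hG r)).of_submatrix_mul id
      (fun c : Fin N × Fin (T / L) => c.2) (fun c => U c.1 r)
  convert key using 1
  ext i c
  simp only [stackedPage, Matrix.of_apply, hx, Matrix.sum_apply, id]
  exact Finset.sum_congr rfl fun r _ => mul_comm _ _

theorem SpatioTemporalFactorModel.abs_le {N T R G : ℕ} {x : Fin N → Fin T → ℝ} {Γ₁ Γ₂ : ℝ}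
    (h₁ : 0 ≤ Γ₁) (h : SpatioTemporalFactorModel x R G Γ₁ Γ₂) (n : Fin N) (t : Fin T) :
    |x n t| ≤ R * (Γ₁ * Γ₂) := by
  obtain ⟨-, U, W, hx, hU, hW, -⟩ := h
  rw [hx]
  calc |∑ r, U n r * W r t| ≤ ∑ r, |U n r * W r t| := Finset.abs_sum_le_sum_abs _ _
    _ ≤ ∑ r : Fin R, Γ₁ * Γ₂ := by
        refine Finset.sum_le_sum fun r _ => ?_
        rw [abs_mul]
        exact mul_le_mul (hU n r) (hW r t) (abs_nonneg _) h₁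
    _ = R * (Γ₁ * Γ₂) := by simp

/-- The stacked Page matrix of the second moments has low rank. -/
theorem stackedPage_sq_add_hasInnerDimLE {N T L r s : ℕ} {x y : Fin N → Fin T → ℝ}
    (hx : HasInnerDimLE (stackedPage L x) r) (hy : HasInnerDimLE (stackedPage L y) s) :
    HasInnerDimLE (stackedPage L fun n t => x n t ^ 2 + y n t) (r * r + s) := by
  convert (hx.hadamard hx).add hy using 1
  ext i c
  simp [stackedPage, sq]

/-! ### Hard singular value thresholding -/

theorem toEuclideanLin_sum_smul_vecMulVec {m n : Type*} [Fintype n] [DecidableEq n] {d : ℕ} (s : Fin d → ℝ)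
    (u : Fin d → EuclideanSpace ℝ m) (v : Fin d → EuclideanSpace ℝ n) (x : EuclideanSpace ℝ n) :
    Matrix.toEuclideanLin (∑ l, s l • Matrix.vecMulVec (u l).ofLp (v l).ofLp) x =
      ∑ l, (s l * inner ℝ (v l) x) • u l := by
  rw [map_sum, LinearMap.sum_apply]
  refine Finset.sum_congr rfl fun l _ => ?_
  ext i
  simp only [map_smul, LinearMap.smul_apply, Matrix.toLpLin_apply, PiLp.smul_apply, smul_eq_mul,
    Matrix.mulVec, dotProduct, Matrix.vecMulVec_apply, PiLp.inner_apply, RCLike.inner_apply,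
    conj_trivial, Finset.mul_sum, Finset.sum_mul]
  exact Finset.sum_congr rfl fun j _ => by ring

theorem IsTruncatedSVD.hasInnerDimLE {m n : Type*} [Fintype m] [Fintype n] {A B : Matrix m n ℝ} {k : ℕ} (h : IsTruncatedSVD k A B) :
    HasInnerDimLE B k := by
  obtain ⟨s, u, v, -, -, -, -, -, hB⟩ := h
  refine ⟨{l : Fin (min (Fintype.card m) (Fintype.card n)) // (l : ℕ) < k}, inferInstance,
    fun i l => s l * u l i, fun l j => v l j, ?_, fun i j => ?_⟩
  · have hinj : Function.Injective
        fun l : {l : Fin (min (Fintype.card m) (Fintype.card n)) // (l : ℕ) < k} =>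
          (⟨l.1, l.2⟩ : Fin k) := fun a b hab => by
      simpa [Fin.ext_iff, Subtype.ext_iff] using hab
    simpa using Fintype.card_le_of_injective _ hinj
  · rw [← Finset.sum_subtype (Finset.univ.filter fun l : Fin _ => (l : ℕ) < k) (by simp)
      fun l => s l * u l i * v l j, Finset.sum_filter, hB, Matrix.sum_apply]
    refine Finset.sum_congr rfl fun l _ => ?_
    rw [Matrix.smul_apply, Matrix.vecMulVec_apply, smul_eq_mul]
    split_ifs <;> ring

section HardThresholding

variable {m n : Type*} [Fintype m] [Fintype n] [DecidableEq n]

theorem rank_eq_finrank_range_toEuclideanLin (A : Matrix m n ℝ) :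
    A.rank = Module.finrank ℝ (LinearMap.range (Matrix.toEuclideanLin A)) := by
  classical
  have e : (Matrix.toEuclideanLin : Matrix m n ℝ ≃ₗ[ℝ] _) =
      Matrix.toLin (PiLp.basisFun 2 ℝ n) (PiLp.basisFun 2 ℝ m) := Matrix.toLpLin_eq_toLin 2 2
  rw [e]
  exact Matrix.rank_eq_finrank_range_toLin A _ _

/-- The squared Frobenius norm is at most the rank times the squared spectral norm. -/
theorem sum_sq_le_rank_mul_specNorm_sq (A : Matrix m n ℝ) :
    ∑ i, ∑ j, A i j ^ 2 ≤ A.rank * specNorm A ^ 2 := by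
  set T := LinearMap.toContinuousLinearMap (Matrix.toEuclideanLin A) with hT
  set V := LinearMap.range (Matrix.toEuclideanLin A) with hV
  let b := stdOrthonormalBasis ℝ V
  have hcol : ∀ i j, A i j = (T (EuclideanSpace.single j 1)) i := by
    intro i j
    simp [hT, Matrix.toLpLin_apply]
  have hnorm : ∀ j, ∑ i, A i j ^ 2 =
      ∑ l, (inner ℝ (b l : EuclideanSpace ℝ m) (T (EuclideanSpace.single j 1))) ^ 2 := by
    intro j
    have e1 : ∑ i, A i j ^ 2 = ‖T (EuclideanSpace.single j 1)‖ ^ 2 := by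
      rw [EuclideanSpace.real_norm_sq_eq]
      exact Finset.sum_congr rfl fun i _ => by rw [hcol]
    have hmem : T (EuclideanSpace.single j 1) ∈ V := ⟨EuclideanSpace.single j 1, rfl⟩
    have e2 := b.sum_sq_norm_inner_right ⟨_, hmem⟩
    rw [Submodule.coe_norm] at e2
    rw [e1, ← e2]
    refine Finset.sum_congr rfl fun l _ => ?_
    rw [Real.norm_eq_abs, sq_abs, Submodule.coe_inner]
  rw [Finset.sum_comm]
  simp_rw [hnorm]
  rw [Finset.sum_comm, rank_eq_finrank_range_toEuclideanLin]
  have hl : ∀ l, ∑ j, (inner ℝ (b l : EuclideanSpace ℝ m) (T (EuclideanSpace.single j 1))) ^ 2 ≤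
      specNorm A ^ 2 := by
    intro l
    -- Each basis vector `b l` of the range contributes `‖Tᵀ b l‖² ≤ ‖T‖²`, and there are `rank A`
    -- of them.
    have e1 : ∑ j, (inner ℝ (b l : EuclideanSpace ℝ m) (T (EuclideanSpace.single j 1))) ^ 2 =
        ‖ContinuousLinearMap.adjoint T (b l : EuclideanSpace ℝ m)‖ ^ 2 := by
      rw [EuclideanSpace.real_norm_sq_eq]
      refine Finset.sum_congr rfl fun j _ => ?_
      rw [← ContinuousLinearMap.adjoint_inner_left, EuclideanSpace.inner_single_right]
      simp
    rw [e1]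
    have e2 : ‖(b l : EuclideanSpace ℝ m)‖ = 1 := by
      rw [← Submodule.coe_norm]
      exact b.orthonormal.1 l
    have e3 := (ContinuousLinearMap.adjoint T).le_opNorm (b l : EuclideanSpace ℝ m)
    rw [e2, mul_one, LinearIsometryEquiv.norm_map] at e3
    exact pow_le_pow_left₀ (norm_nonneg _) e3 2
  refine (Finset.sum_le_card_nsmul _ _ _ fun l _ => hl l).trans_eq ?_
  rw [Finset.card_univ, Fintype.card_fin, nsmul_eq_mul]

theorem norm_sq_sum_smul {E : Type*} [NormedAddCommGroup E] [InnerProductSpace ℝ E] {d : ℕ}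
    {u : Fin d → E} (hu : Orthonormal ℝ u) (a : Fin d → ℝ) :
    ‖∑ l, a l • u l‖ ^ 2 = ∑ l, a l ^ 2 := by
  rw [← real_inner_self_eq_norm_sq, hu.inner_sum]
  exact Finset.sum_congr rfl fun l _ => by simp [sq]

/-- A singular value beyond the rank of `M` is at most the spectral norm of `A - M`. -/
theorem singularValue_le_specNorm_sub {A M : Matrix m n ℝ} {d k : ℕ} {s : Fin d → ℝ}
    {u : Fin d → EuclideanSpace ℝ m} {v : Fin d → EuclideanSpace ℝ n} (hs : Antitone s)
    (hs0 : ∀ l, 0 ≤ s l) (hu : Orthonormal ℝ u) (hv : Orthonormal ℝ v)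
    (hA : A = ∑ l, s l • Matrix.vecMulVec (u l).ofLp (v l).ofLp) (hM : M.rank ≤ k) (hk : k < d) :
    s ⟨k, hk⟩ ≤ specNorm (A - M) := by
  have hkd : k + 1 ≤ d := hk
  set ι : Fin (k + 1) → Fin d := Fin.castLE hkd with hι
  have hinj : Function.Injective ι := Fin.castLE_injective hkd
  have hu' : Orthonormal ℝ (u ∘ ι) := hu.comp ι hinj
  have hv' : Orthonormal ℝ (v ∘ ι) := hv.comp ι hinj
  let φ : (Fin (k + 1) → ℝ) →ₗ[ℝ] LinearMap.range (Matrix.toEuclideanLin M) :=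
    (Matrix.toEuclideanLin M).rangeRestrict ∘ₗ Fintype.linearCombination ℝ (v ∘ ι)
  -- The first `k + 1` right singular vectors span a space of dimension exceeding `rank M`, so some
  -- nonzero `x` in it is killed by `M`. There `A` stretches by at least `s ⟨k, hk⟩`, while `A x =
  -- (A - M) x`.
  have hker : LinearMap.ker φ ≠ ⊥ := by
    apply LinearMap.ker_ne_bot_of_finrank_lt
    rw [← rank_eq_finrank_range_toEuclideanLin]
    simpa using Nat.lt_succ_of_le hM
  obtain ⟨c, hc, hc0⟩ := Submodule.exists_mem_ne_zero_of_ne_bot hker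
  set x : EuclideanSpace ℝ n := ∑ a, c a • (v ∘ ι) a with hx
  have hMx : Matrix.toEuclideanLin M x = 0 := congrArg Subtype.val (LinearMap.mem_ker.1 hc)
  have hxn : ‖x‖ ^ 2 = ∑ a, c a ^ 2 := norm_sq_sum_smul hv' c
  have hxpos : 0 < ‖x‖ ^ 2 := by
    rw [hxn]
    obtain ⟨a, ha⟩ := Function.ne_iff.1 hc0
    exact Finset.sum_pos' (fun a _ => sq_nonneg _)
      ⟨a, Finset.mem_univ _, sq_pos_of_ne_zero ha⟩
  have hvx : ∀ a, inner ℝ (v (ι a)) x = c a := fun a => hv'.inner_right_fintype c a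
  have huA : ∀ a, inner ℝ ((u ∘ ι) a) (Matrix.toEuclideanLin A x) = s (ι a) * c a := by
    intro a
    rw [hA, toEuclideanLin_sum_smul_vecMulVec]
    exact (hu.inner_right_fintype _ (ι a)).trans (by rw [hvx])
  have hbessel := hu'.sum_inner_products_le (Matrix.toEuclideanLin A x) (s := Finset.univ)
  have hlow : s ⟨k, hk⟩ ^ 2 * ‖x‖ ^ 2 ≤ ‖Matrix.toEuclideanLin A x‖ ^ 2 := by
    refine le_trans ?_ hbessel
    rw [hxn, Finset.mul_sum]
    refine Finset.sum_le_sum fun a _ => ?_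
    rw [huA, Real.norm_eq_abs, sq_abs, mul_pow]
    have : s ⟨k, hk⟩ ≤ s (ι a) := hs (by
      rw [Fin.le_def]
      exact Nat.lt_succ_iff.1 a.isLt)
    have h0 := hs0 ⟨k, hk⟩
    gcongr
  have hup : ‖Matrix.toEuclideanLin A x‖ ≤ specNorm (A - M) * ‖x‖ := by
    have e := norm_toEuclideanLin_le (A - M) x
    rwa [map_sub, LinearMap.sub_apply, hMx, sub_zero] at e
  have h1 : s ⟨k, hk⟩ ^ 2 * ‖x‖ ^ 2 ≤ specNorm (A - M) ^ 2 * ‖x‖ ^ 2 := by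
    rw [← mul_pow (specNorm _)]
    exact hlow.trans (pow_le_pow_left₀ (norm_nonneg _) hup 2)
  exact le_of_sq_le_sq (le_of_mul_le_mul_right h1 hxpos) (specNorm_nonneg _)

/-- The discarded terms have singular values at most the `(k+1)`-st, which Weyl's inequality bounds.
-/
theorem IsTruncatedSVD.specNorm_sub_le {A B M : Matrix m n ℝ} {k : ℕ}
    (h : IsTruncatedSVD k A B) (hM : M.rank ≤ k) : specNorm (B - A) ≤ specNorm (A - M) := by
  obtain ⟨s, u, v, hs, hs0, hu, hv, hA, hB⟩ := h
  refine ContinuousLinearMap.opNorm_le_bound _ (specNorm_nonneg _) fun x => ?_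
  have hBA : B - A = ∑ l : Fin (min (Fintype.card m) (Fintype.card n)),
      (if (l : ℕ) < k then 0 else -s l) • Matrix.vecMulVec (u l).ofLp (v l).ofLp := by
    rw [hA, hB, ← Finset.sum_sub_distrib]
    refine Finset.sum_congr rfl fun l _ => ?_
    rw [← sub_smul]
    split_ifs <;> simp
  refine le_of_sq_le_sq ?_ (mul_nonneg (specNorm_nonneg _) (norm_nonneg x))
  rw [LinearMap.coe_toContinuousLinearMap', hBA, toEuclideanLin_sum_smul_vecMulVec,
    norm_sq_sum_smul hu, mul_pow]
  refine le_trans ?_ (mul_le_mul_of_nonneg_left (hv.sum_inner_products_le x (s := Finset.univ))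
    (sq_nonneg _))
  rw [Finset.mul_sum]
  refine Finset.sum_le_sum fun l _ => ?_
  rw [Real.norm_eq_abs, sq_abs, mul_pow]
  refine mul_le_mul_of_nonneg_right ?_ (sq_nonneg _)
  split_ifs with hl
  · rw [zero_pow two_ne_zero]
    exact sq_nonneg _
  · rw [neg_sq]
    have hk : k < min (Fintype.card m) (Fintype.card n) := (not_lt.1 hl).trans_lt l.isLt
    have h1 : s l ≤ s ⟨k, hk⟩ := hs (not_lt.1 hl)
    exact pow_le_pow_left₀ (hs0 l)
      (h1.trans (singularValue_le_specNorm_sub hs hs0 hu hv hA hM hk)) 2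

/-- Hard singular value thresholding: the Frobenius error is controlled by the spectral norm of
the noise. -/
theorem IsTruncatedSVD.sum_sq_sub_le {A B M : Matrix m n ℝ} {k : ℕ}
    (h : IsTruncatedSVD k A B) (hM : M.rank ≤ k) :
    ∑ i, ∑ j, (B i j - M i j) ^ 2 ≤ 8 * k * specNorm (A - M) ^ 2 := by
  have hrank : (B - M).rank ≤ k + k := by
    refine HasInnerDimLE.rank_le ?_
    have := h.hasInnerDimLE.add
      ((HasInnerDimLE.of_rank_le hM).of_submatrix_mul id id fun _ => -1)
    convert this using 1
    ext i j
    simp [sub_eq_add_neg]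
  have hspec : specNorm (B - M) ≤ 2 * specNorm (A - M) := by
    have := specNorm_add_le (B - A) (A - M)
    rw [sub_add_sub_cancel] at this
    linarith [h.specNorm_sub_le hM]
  calc ∑ i, ∑ j, (B i j - M i j) ^ 2 ≤ (B - M).rank * specNorm (B - M) ^ 2 :=
        sum_sq_le_rank_mul_specNorm_sq (B - M)
    _ ≤ ((k + k : ℕ) : ℝ) * (2 * specNorm (A - M)) ^ 2 := by
        have := specNorm_nonneg (B - M)
        gcongr
    _ = _ := by
        push_cast
        ring

end HardThresholding

/-! ### Moments of the noise and of the squared observations -/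

section Moments

variable {Ω : Type*} [MeasurableSpace Ω] {μ : Measure Ω}

theorem eLpNorm_le_of_psiTwoNorm_le {Z : Ω → ℝ} {γ : ℝ}
    (h : psiTwoNorm Z μ ≤ ENNReal.ofReal γ) {p : ℕ} (hp : 1 ≤ p) :
    eLpNorm Z p μ ≤ ENNReal.ofReal (|γ| * √p) := by
  have hp1 : (1 : ℝ) ≤ p := by exact_mod_cast hp
  have hp0 : (0 : ℝ) < p := by linarith
  have h1 : ENNReal.ofReal ((p : ℝ) ^ (-(1 / 2) : ℝ)) * eLpNorm Z p μ ≤ ENNReal.ofReal γ := by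
    have := (le_iSup₂ (f := fun (p : ℝ) (_ : 1 ≤ p) =>
      ENNReal.ofReal (p ^ (-(1 / 2) : ℝ)) * eLpNorm Z (ENNReal.ofReal p) μ) (p : ℝ) hp1).trans h
    rwa [ENNReal.ofReal_natCast] at this
  have h2 : √(p : ℝ) * (p : ℝ) ^ (-(1 / 2) : ℝ) = 1 := by
    rw [Real.sqrt_eq_rpow, ← Real.rpow_add hp0]
    norm_num
  calc eLpNorm Z p μ
      = ENNReal.ofReal √p * (ENNReal.ofReal ((p : ℝ) ^ (-(1 / 2) : ℝ)) * eLpNorm Z p μ) := by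
        rw [← mul_assoc, ← ENNReal.ofReal_mul (Real.sqrt_nonneg _), h2, ENNReal.ofReal_one,
          one_mul]
    _ ≤ ENNReal.ofReal √p * ENNReal.ofReal |γ| := by
        gcongr
        exact h1.trans (ENNReal.ofReal_le_ofReal (le_abs_self γ))
    _ = _ := by rw [← ENNReal.ofReal_mul (Real.sqrt_nonneg _), mul_comm]

theorem memLp_two_of_psiTwoNorm_le {Z : Ω → ℝ} (hZ : Measurable Z) {γ : ℝ}
    (h : psiTwoNorm Z μ ≤ ENNReal.ofReal γ) : MemLp Z 2 μ := by
  refine ⟨hZ.aestronglyMeasurable, ?_⟩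
  have := eLpNorm_le_of_psiTwoNorm_le h (p := 2) one_le_two
  exact (by exact_mod_cast this : eLpNorm Z 2 μ ≤ _).trans_lt ENNReal.ofReal_lt_top

variable [IsProbabilityMeasure μ]

/-- Uses `‖Y²‖_p = ‖Y‖_{2p}²`: the growth `√p` of sub-gaussian norms becomes linear after squaring.
-/
theorem eLpNorm_sq_le_of_psiTwoNorm_le {Z : Ω → ℝ} (hZ : Measurable Z) {γ a F : ℝ}
    (h : psiTwoNorm Z μ ≤ ENNReal.ofReal γ) (ha : |a| ≤ F) {p : ℕ} (hp : 1 ≤ p) :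
    eLpNorm (fun ω => (a + Z ω) ^ 2) p μ ≤ ENNReal.ofReal ((2 * F ^ 2 + 4 * γ ^ 2) * p) := by
  have hp1 : (1 : ℝ) ≤ p := by exact_mod_cast hp
  have hF : 0 ≤ F := (abs_nonneg a).trans ha
  have h1 : eLpNorm (fun ω => a + Z ω) ((2 * p : ℕ) : ℝ≥0∞) μ ≤
      ENNReal.ofReal (F + |γ| * √((2 * p : ℕ) : ℝ)) := by
    refine (eLpNorm_add_le (f := fun _ => a) (g := Z) aestronglyMeasurable_const
      hZ.aestronglyMeasurable (by exact_mod_cast (by omega : 1 ≤ 2 * p))).trans ?_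
    rw [ENNReal.ofReal_add hF (by positivity)]
    gcongr
    · rw [eLpNorm_const _ (by exact_mod_cast (by omega : 2 * p ≠ 0)) (NeZero.ne μ), measure_univ,
        ENNReal.one_rpow, mul_one, Real.enorm_eq_ofReal_abs]
      exact ENNReal.ofReal_le_ofReal ha
    · exact eLpNorm_le_of_psiTwoNorm_le h (by omega)
  have h2 := eLpNorm_norm_rpow (p := (p : ℝ≥0∞)) (μ := μ) (fun ω => a + Z ω) (q := 2) two_pos
  have e1 : (fun ω => ‖a + Z ω‖ ^ (2 : ℝ)) = fun ω => (a + Z ω) ^ 2 := by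
    funext ω
    rw [Real.rpow_two, Real.norm_eq_abs, sq_abs]
  have e2 : (p : ℝ≥0∞) * ENNReal.ofReal 2 = ((2 * p : ℕ) : ℝ≥0∞) := by
    rw [ENNReal.ofReal_ofNat]
    push_cast
    ring
  rw [e1, e2, ENNReal.rpow_two] at h2
  rw [h2]
  calc _ ≤ ENNReal.ofReal (F + |γ| * √((2 * p : ℕ) : ℝ)) ^ 2 := by gcongr
    _ = ENNReal.ofReal ((F + |γ| * √((2 * p : ℕ) : ℝ)) ^ 2) :=
        (ENNReal.ofReal_pow (by positivity) 2).symm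
    _ ≤ _ := by
        apply ENNReal.ofReal_le_ofReal
        have e3 : (|γ| * √((2 * p : ℕ) : ℝ)) ^ 2 = 2 * γ ^ 2 * p := by
          rw [mul_pow, sq_abs, Real.sq_sqrt (by positivity)]
          push_cast
          ring
        nlinarith [sq_nonneg (F - |γ| * √((2 * p : ℕ) : ℝ)), sq_nonneg F]

/-- The centered square of a shifted sub-gaussian variable has sub-exponential moments. -/
theorem eLpNorm_centered_sq_le_of_psiTwoNorm_le {Z : Ω → ℝ} (hZ : Measurable Z) {γ a F : ℝ}
    (h : psiTwoNorm Z μ ≤ ENNReal.ofReal γ) (ha : |a| ≤ F) {p : ℕ} (hp : 1 ≤ p) :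
    eLpNorm (fun ω => (a + Z ω) ^ 2 - ∫ ω, (a + Z ω) ^ 2 ∂μ) p μ ≤
      ENNReal.ofReal ((4 * F ^ 2 + 8 * γ ^ 2 + 1) * p) := by
  have hm : AEStronglyMeasurable (fun ω => (a + Z ω) ^ 2) μ :=
    ((hZ.const_add a).pow_const 2).aestronglyMeasurable
  have hsq := eLpNorm_sq_le_of_psiTwoNorm_le hZ h ha hp
  have hp1 : (1 : ℝ≥0∞) ≤ p := by exact_mod_cast hp
  -- The mean is bounded by the `p`-th norm, so centering at most doubles the constant; the extra
  -- `1` in the final bound keeps it positive.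
  have hc : eLpNorm (fun _ : Ω => ∫ ω, (a + Z ω) ^ 2 ∂μ) p μ ≤
      ENNReal.ofReal ((2 * F ^ 2 + 4 * γ ^ 2) * p) := by
    rw [eLpNorm_const _ (by exact_mod_cast (by omega : p ≠ 0)) (NeZero.ne μ), measure_univ,
      ENNReal.one_rpow, mul_one]
    refine (enorm_integral_le_lintegral_enorm _).trans ?_
    rw [← eLpNorm_one_eq_lintegral_enorm]
    exact (eLpNorm_le_eLpNorm_of_exponent_le hp1 hm).trans hsq
  refine (eLpNorm_sub_le hm aestronglyMeasurable_const hp1).trans ((add_le_add hsq hc).trans ?_)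
  rw [← ENNReal.ofReal_add (by positivity) (by positivity)]
  apply ENNReal.ofReal_le_ofReal
  have : (0 : ℝ) ≤ p := by positivity
  linarith

end Moments

/-! ### Error of mSSA on fully observed data -/

section PageMatrix

variable {N T L : ℕ}

/-- The reading-off map of the Page matrix as a bijection. -/
def pageEquiv (hLT : L ∣ T) : Fin T ≃ Fin L × Fin (T / L) where
  toFun t := (pageRow hLT t, pageCol hLT t)
  invFun p := pageTime p.1 p.2
  left_inv t := pageTime_pageRow_pageCol hLT t
  right_inv p := by
    have hL : 0 < L := Fin.pos p.1
    refine Prod.ext (Fin.ext ?_) (Fin.ext ?_)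
    · simp [pageRow, pageTime, Nat.mod_eq_of_lt p.1.isLt]
    · simp [pageCol, pageTime, Nat.add_mul_div_right _ _ hL, Nat.div_eq_of_lt p.1.isLt]

theorem sum_pageRow_pageCol (hLT : L ∣ T) (φ : Fin L → Fin N × Fin (T / L) → ℝ) :
    ∑ n, ∑ t, φ (pageRow hLT t) (n, pageCol hLT t) = ∑ i, ∑ c, φ i c := by
  have h : ∀ n, ∑ t, φ (pageRow hLT t) (n, pageCol hLT t) = ∑ i, ∑ j, φ i (n, j) := fun n => by
    rw [← Fintype.sum_prod_type' fun i j => φ i (n, j)]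
    exact (pageEquiv hLT).sum_comp fun p => φ p.1 (n, p.2)
  simp_rw [h]
  rw [Finset.sum_comm]
  exact Finset.sum_congr rfl fun i _ => (Fintype.sum_prod_type' fun n j => φ i (n, j)).symm

theorem pageTime_injective (hLT : L ∣ T) :
    Function.Injective fun p : Fin L × (Fin N × Fin (T / L)) =>
      ((p.2.1, pageTime p.1 p.2.2) : Fin N × Fin T) := by
  rintro ⟨i, n, j⟩ ⟨i', n', j'⟩ h
  simp only [Prod.mk.injEq] at h
  have := (pageEquiv hLT).symm.injective (a₁ := (i, j)) (a₂ := (i', j')) h.2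
  simp only [Prod.mk.injEq] at this
  rw [h.1, this.1, this.2]

theorem observedFraction_some (hNT : 1 ≤ N * T) (X : Fin N → Fin T → ℝ) :
    observedFraction (fun n t => some (X n t)) = 1 := by
  have h : (Finset.univ.filter fun p : Fin N × Fin T => (some (X p.1 p.2)).isSome).card =
      N * T := by simp
  have hne : ((N * T : ℕ) : ℝ) ≠ 0 := by exact_mod_cast (by omega : N * T ≠ 0)
  rw [observedFraction, h, max_eq_right hNT, ← Nat.cast_mul, div_self hne]

/-- The expected error of mSSA on fully observed data with independent sub-exponential noise, in
the form of an integrable upper bound. -/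
theorem exists_integrable_mssa_error_le {Ω : Type*} [MeasurableSpace Ω] {μ : Measure Ω}
    [IsProbabilityMeasure μ] (hLT : L ∣ T) (hNT : 2 ≤ N * T) {k : ℕ} {M : Fin N → Fin T → ℝ}
    {Y : Fin N → Fin T → Ω → ℝ} (hmeas : ∀ n t, Measurable (Y n t))
    (hindep : iIndepFun (fun p : Fin N × Fin T => Y p.1 p.2) μ)
    (hmean : ∀ n t, ∫ ω, (Y n t ω - M n t) ∂μ = 0) {K : ℝ} (hK : 0 < K)
    (hmom : ∀ n t, ∀ p : ℕ, 1 ≤ p →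
      eLpNorm (fun ω => Y n t ω - M n t) p μ ≤ ENNReal.ofReal (K * p))
    (hrank : (stackedPage L M).rank ≤ k) {est : Ω → Fin N → Fin T → ℝ}
    (hest : ∀ᵐ ω ∂μ, IsMSSAEstimate hLT k (fun n t => some (Y n t ω)) (est ω)) :
    ∃ H : Ω → ℝ, Integrable H μ ∧
      (∀ᵐ ω ∂μ, ∑ n, ∑ t, (est ω n t - M n t) ^ 2 ≤ H ω) ∧
      ∫ ω, H ω ∂μ ≤ 720000 * k * ((L : ℝ) + N * (T / L : ℕ)) * K ^ 2 *
        Real.log ((N : ℝ) * T) ^ 2 := by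
  have hcard : L * (N * (T / L)) = N * T := by
    rw [mul_left_comm, Nat.mul_div_cancel' hLT]
  obtain ⟨H, hHi, hH, hHle⟩ := exists_integrable_specNorm_sq_le (μ := μ)
    (ξ := fun (i : Fin L) (c : Fin N × Fin (T / L)) ω =>
      Y c.1 (pageTime i c.2) ω - M c.1 (pageTime i c.2))
    (by simpa [hcard] using hNT) (fun i c => (hmeas _ _).sub_const _)
    ((hindep.precomp (pageTime_injective hLT)).comp
      (fun p y => y - M p.2.1 (pageTime p.1 p.2.2)) fun p => by fun_prop)
    (fun i c => hmean _ _) hK (fun i c => hmom _ _)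
  refine ⟨fun ω => 8 * k * H ω, hHi.const_mul _, ?_, ?_⟩
  · filter_upwards [hest] with ω hω
    obtain ⟨B, hB, he⟩ := hω
    rw [observedFraction_some (by omega)] at he
    have hsum : ∑ n, ∑ t, (est ω n t - M n t) ^ 2 =
        ∑ i, ∑ c, (B i c - stackedPage L M i c) ^ 2 := by
      rw [← sum_pageRow_pageCol hLT]
      refine Finset.sum_congr rfl fun n _ => Finset.sum_congr rfl fun t _ => ?_
      rw [he, inv_one, one_mul, stackedPage, Matrix.of_apply, pageTime_pageRow_pageCol]
    rw [hsum]
    refine (hB.sum_sq_sub_le hrank).trans ?_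
    gcongr
    exact hH ω
  · rw [integral_const_mul]
    have e : (Fintype.card (Fin L) : ℝ) * Fintype.card (Fin N × Fin (T / L)) = (N : ℝ) * T := by
      rw [← Nat.cast_mul, ← Nat.cast_mul, ← hcard]
      simp
    rw [e] at hHle
    simp only [Fintype.card_fin, Fintype.card_prod, Nat.cast_mul] at hHle
    calc 8 * (k : ℝ) * ∫ ω, H ω ∂μ ≤ 8 * k * (90000 * ((L : ℝ) + N * (T / L : ℕ)) * K ^ 2 *
          Real.log ((N : ℝ) * T) ^ 2) := by gcongr
      _ = _ := by ring

/-- The dimensions of the stacked Page matrix are of the order `NT / √(min(N, T) T)`. -/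
theorem page_dimensions_le (hNT : 1 ≤ N * T) (hL : L = Nat.sqrt (min N T * T)) (hLT : L ∣ T) :
    1 / ((N : ℝ) * T) * ((L : ℝ) + N * (T / L : ℕ)) ≤ 3 / √(((min N T : ℕ) : ℝ) * T) := by
  have hN : 0 < N := Nat.pos_of_mul_pos_right hNT
  have hT : 0 < T := Nat.pos_of_mul_pos_left hNT
  have hN' : (0 : ℝ) < N := by exact_mod_cast hN
  have hT' : (0 : ℝ) < T := by exact_mod_cast hT
  have hLpos : 0 < L := Nat.pos_of_dvd_of_pos hLT hT
  have hL' : (1 : ℝ) ≤ L := by exact_mod_cast hLpos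
  have hmin : (0 : ℝ) < (min N T : ℕ) := by exact_mod_cast lt_min hN hT
  set d : ℝ := ((min N T : ℕ) : ℝ) * T with hd
  have hdpos : 0 < d := by positivity
  have hs : 0 < √d := Real.sqrt_pos.2 hdpos
  have hss : √d * √d = d := Real.mul_self_sqrt hdpos.le
  have h1 : (L : ℝ) ≤ √d := by
    apply Real.le_sqrt_of_sq_le
    rw [hd, hL, sq]
    exact_mod_cast Nat.sqrt_le (min N T * T)
  -- Rounding down costs at most a factor `2`, as `L ≥ 1`.
  have h2 : √d ≤ 2 * L := by
    have : √d ≤ L + 1 := by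
      rw [Real.sqrt_le_left (by positivity), hd, hL, sq]
      exact_mod_cast (Nat.lt_succ_sqrt (min N T * T)).le
    linarith
  have h3 : d ≤ N * T := by
    rw [hd]
    gcongr
    exact_mod_cast min_le_left N T
  rw [Nat.cast_div hLT (by positivity), mul_add]
  have e1 : 1 / ((N : ℝ) * T) * L ≤ 1 / √d := by
    calc 1 / ((N : ℝ) * T) * L ≤ 1 / d * √d := by gcongr
      _ = 1 / √d := by
          nth_rw 1 [← hss]
          field_simp
  have e2 : 1 / ((N : ℝ) * T) * (N * (T / L)) ≤ 2 / √d := by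
    have : 1 / ((N : ℝ) * T) * (N * (T / L)) = 1 / L := by field_simp
    rw [this, div_le_div_iff₀ (by positivity) hs]
    linarith
  calc _ ≤ 1 / √d + 2 / √d := add_le_add e1 e2
    _ = 3 / √d := by ring

end PageMatrix

/-! ### From the two mean estimates to the variance estimate -/

/-- Puts every admissible truncation parameter in the form (polynomial in `R`, `R'`) times `G² +
G'`; `G ≥ 1` gives `2G + 1 ≤ 3G` and lets `G²` absorb the constant term of `2G' + 1`. -/
theorem nat_rank_bounds {R G R' G' : ℕ} (hG : 1 ≤ G) :
    (R * (2 * G + 1)) * (R * (2 * G + 1)) + R' * (2 * G' + 1) ≤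
        (9 * R ^ 2 + 2 * R') * (G ^ 2 + G') ∧
      R * (2 * G + 1) ≤ (9 * R ^ 2 + 2 * R') * (G ^ 2 + G') ∧
      (R * G) ^ 2 + R' * G' ≤ (9 * R ^ 2 + 2 * R') * (G ^ 2 + G') := by
  have h1 : R * (2 * G + 1) ≤ 3 * (R * G) := by nlinarith
  have h2 : R * G ≤ (R * G) ^ 2 := Nat.le_self_pow two_ne_zero _
  have h3 : (R * (2 * G + 1)) * (R * (2 * G + 1)) ≤ (3 * (R * G)) * (3 * (R * G)) :=
    Nat.mul_le_mul h1 h1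
  have h4 : R' * 1 ≤ R' * G ^ 2 := Nat.mul_le_mul_left _ (Nat.one_le_pow _ _ hG)
  refine ⟨?_, ?_, ?_⟩ <;> nlinarith

/-- The error of the variance estimate is controlled by the errors of the two estimates. -/
theorem sq_sub_varianceEstimate_le {v f fh gh F Γ : ℝ} (hv : 0 ≤ v) (hf : |f| ≤ F)
    (hfh : |fh| ≤ Γ) :
    (v - max 0 (gh - fh ^ 2)) ^ 2 ≤
      2 * (gh - (f ^ 2 + v)) ^ 2 + 2 * ((2 * F ^ 2 + 2 * Γ ^ 2) * (fh - f) ^ 2) := by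
  -- Clipping at `0` is `1`-Lipschitz and fixes `v ≥ 0`.
  have h1 : |v - max 0 (gh - fh ^ 2)| ≤ |v - (gh - fh ^ 2)| := by
    have := abs_max_sub_max_le_abs v (gh - fh ^ 2) 0
    rwa [max_eq_left hv, max_comm _ (0 : ℝ)] at this
  have h2 : (v - max 0 (gh - fh ^ 2)) ^ 2 ≤ (v - (gh - fh ^ 2)) ^ 2 := sq_le_sq.2 h1
  have h3 : f ^ 2 ≤ F ^ 2 := sq_le_sq.2 (hf.trans (le_abs_self F))
  have h4 : fh ^ 2 ≤ Γ ^ 2 := sq_le_sq.2 (hfh.trans (le_abs_self Γ))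
  have h5 : (fh + f) ^ 2 ≤ 2 * F ^ 2 + 2 * Γ ^ 2 := by nlinarith [sq_nonneg (fh - f)]
  have h6 : (fh + f) ^ 2 * (fh - f) ^ 2 ≤ (2 * F ^ 2 + 2 * Γ ^ 2) * (fh - f) ^ 2 := by gcongr
  have h7 : (v - (gh - fh ^ 2)) ^ 2 ≤
      2 * (gh - (f ^ 2 + v)) ^ 2 + 2 * ((fh + f) ^ 2 * (fh - f) ^ 2) := by
    nlinarith [sq_nonneg ((gh - (f ^ 2 + v)) + (fh + f) * (fh - f))]
  linarith

theorem mainTheorem3 :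
    -- one polynomial in the eight model parameters serves for all sizes, models and noises
    ∃ P : MvPolynomial (Fin 8) ℝ,
      ∀ (N T L R G R' G' k₁ k₂ : ℕ) (Γ₁ Γ₂ Γ₃ Γ₁' Γ₂' γ c : ℝ)
        (Ω : Type*) [MeasurableSpace Ω] (μ : Measure Ω) [IsProbabilityMeasure μ]
        (f : Fin N → Fin T → ℝ) (η : Fin N → Fin T → Ω → ℝ)
        (fhat ghat : Ω → Fin N → Fin T → ℝ)
        (hLT : L ∣ T),
        2 ≤ N * T →
        L = Nat.sqrt (min N T * T) →
        1 ≤ G →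
        0 < Γ₁ → 0 < Γ₂ → 0 < Γ₁' → 0 < Γ₂' → 0 < c →
        -- the model for the mean, the noise and the variance
        SpatioTemporalFactorModel f R G Γ₁ Γ₂ →
        SubgaussianNoise μ η γ →
        BalancedSpectra L f c →
        SpatioTemporalFactorModel (noiseVariance μ η) R' G' Γ₁' Γ₂' →
        BalancedSpectra L (noiseVariance μ η) c →
        -- the truncation parameters of the two applications of mSSA
        (stackedPage L f).rank ≤ k₁ →
        k₁ ≤ max (stackedPage L f).rank ((R * G) ^ 2 + R' * G') →
        (stackedPage L fun n t => f n t ^ 2 + noiseVariance μ η n t).rank ≤ k₂ →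
        k₂ ≤ max (stackedPage L fun n t => f n t ^ 2 + noiseVariance μ η n t).rank
          ((R * G) ^ 2 + R' * G') →
        -- the two estimates
        (∀ n t, AEMeasurable (fun ω => fhat ω n t) μ) →
        (∀ n t, AEMeasurable (fun ω => ghat ω n t) μ) →
        (∀ᵐ ω ∂μ, IsMSSAEstimate hLT k₁ (observation f η ω) (fhat ω)) →
        (∀ᵐ ω ∂μ, IsMSSAEstimate hLT k₂ (squaredObservation (observation f η ω)) (ghat ω)) →
        (∀ᵐ ω ∂μ, ∀ n t, |fhat ω n t| ≤ Γ₃) →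
        (∀ n t, Integrable (fun ω =>
          (noiseVariance μ η n t - varianceEstimate (fhat ω) (ghat ω) n t) ^ 2) μ) ∧
        1 / ((N : ℝ) * (T : ℝ)) * ∑ n, ∑ t,
            ∫ ω, (noiseVariance μ η n t - varianceEstimate (fhat ω) (ghat ω) n t) ^ 2 ∂μ ≤
          MvPolynomial.eval ![Γ₁, Γ₂, Γ₃, Γ₁', Γ₂', γ, (R : ℝ), (R' : ℝ)] P *
            (((G : ℝ) ^ 2 + (G' : ℝ)) * Real.log ((N : ℝ) * (T : ℝ)) ^ 2 /
              √(((min N T : ℕ) : ℝ) * (T : ℝ))) := by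
  -- This is `4320000 (9R² + 2R') (K₂² + Q K₁²)` with the abbreviations set below; `4320000 = 720000
  -- · 2 · 3`, from the mSSA error, the split into two errors and the matrix dimensions.
  refine ⟨MvPolynomial.C 4320000 *
    (MvPolynomial.C 9 * MvPolynomial.X 6 ^ 2 + MvPolynomial.C 2 * MvPolynomial.X 7) *
    ((MvPolynomial.C 4 * (MvPolynomial.X 6 * (MvPolynomial.X 0 * MvPolynomial.X 1)) ^ 2 +
        MvPolynomial.C 8 * MvPolynomial.X 5 ^ 2 + MvPolynomial.C 1) ^ 2 +
      (MvPolynomial.C 2 * (MvPolynomial.X 6 * (MvPolynomial.X 0 * MvPolynomial.X 1)) ^ 2 +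
        MvPolynomial.C 2 * MvPolynomial.X 2 ^ 2) * (MvPolynomial.X 5 ^ 2 + MvPolynomial.C 1) ^ 2),
    ?_⟩
  intro N T L R G R' G' k₁ k₂ Γ₁ Γ₂ Γ₃ Γ₁' Γ₂' γ c Ω _ μ _ f η fhat ghat hLT hNT hL hG hΓ₁ hΓ₂
    hΓ₁' hΓ₂' _ hf hη _ hv _ hk₁ hk₁' hk₂ hk₂' hfm hgm hfe hge hfb
  set F : ℝ := R * (Γ₁ * Γ₂) with hF
  set Q : ℝ := 2 * F ^ 2 + 2 * Γ₃ ^ 2 with hQ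
  set K₁ : ℝ := γ ^ 2 + 1 with hK₁
  set K₂ : ℝ := 4 * F ^ 2 + 8 * γ ^ 2 + 1 with hK₂
  have hQ0 : 0 ≤ Q := by positivity
  have hfF : ∀ n t, |f n t| ≤ F := hf.abs_le hΓ₁.le
  have hmem : ∀ n t, MemLp (η n t) 2 μ := fun n t =>
    memLp_two_of_psiTwoNorm_le (hη.measurable n t) (hη.psi_two_le n t)
  have hmean2 : ∀ n t, ∫ ω, (f n t + η n t ω) ^ 2 ∂μ = f n t ^ 2 + noiseVariance μ η n t := by
    intro n t
    have hi := (hmem n t).integrable one_le_two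
    have hi2 := (hmem n t).integrable_sq
    have e : (fun ω => (f n t + η n t ω) ^ 2) =
        fun ω => (f n t ^ 2 + 2 * f n t * η n t ω) + η n t ω ^ 2 := by
      funext ω
      ring
    have hi1 : Integrable (fun ω => f n t ^ 2 + 2 * f n t * η n t ω) μ :=
      (integrable_const _).add (hi.const_mul _)
    rw [e, integral_add hi1 hi2,
      integral_add (integrable_const _) (hi.const_mul _), integral_const_mul, hη.mean_zero]
    simp [noiseVariance]
  have hsqi : ∀ n t, Integrable (fun ω => (f n t + η n t ω) ^ 2) μ := fun n t =>
    ((memLp_const (f n t)).add (hmem n t)).integrable_sq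
  obtain ⟨H₁, hH₁i, hH₁, hH₁le⟩ := exists_integrable_mssa_error_le (μ := μ) hLT hNT (M := f)
    (Y := fun n t ω => f n t + η n t ω) (fun n t => (hη.measurable n t).const_add _)
    (hη.indep.comp (fun p x => f p.1 p.2 + x) fun p => by fun_prop)
    (fun n t => by simpa using hη.mean_zero n t) (K := K₁) (by positivity)
    (fun n t p hp => by
      simp only [add_sub_cancel_left]
      refine (eLpNorm_le_of_psiTwoNorm_le (hη.psi_two_le n t) hp).trans
        (ENNReal.ofReal_le_ofReal ?_)
      have hp1 : (1 : ℝ) ≤ p := by exact_mod_cast hp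
      have h1 : √(p : ℝ) ≤ p := by
        rw [Real.sqrt_le_left (by positivity)]
        nlinarith
      -- `γ² + 1` serves as a positive upper bound for `|γ|` that is polynomial in `γ`.
      have h2 : |γ| ≤ K₁ := by
        rw [hK₁, ← sq_abs]
        nlinarith [sq_nonneg (|γ| - 1), abs_nonneg γ]
      exact mul_le_mul h2 h1 (Real.sqrt_nonneg _) (by positivity)) hk₁ hfe
  obtain ⟨H₂, hH₂i, hH₂, hH₂le⟩ := exists_integrable_mssa_error_le (μ := μ) hLT hNT
    (M := fun n t => f n t ^ 2 + noiseVariance μ η n t)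
    (Y := fun n t ω => (f n t + η n t ω) ^ 2)
    (fun n t => ((hη.measurable n t).const_add _).pow_const 2)
    (hη.indep.comp (fun p x => (f p.1 p.2 + x) ^ 2) fun p => by fun_prop)
    (fun n t => by
      rw [integral_sub (hsqi n t) (integrable_const _), hmean2]
      simp) (K := K₂) (by positivity)
    (fun n t p hp => by
      have := eLpNorm_centered_sq_le_of_psiTwoNorm_le (hη.measurable n t) (hη.psi_two_le n t)
        (hfF n t) hp
      rwa [hmean2] at this) hk₂ hge
  have hv0 : ∀ n t, 0 ≤ noiseVariance μ η n t := fun n t =>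
    integral_nonneg fun ω => sq_nonneg _
  have hpt : ∀ᵐ ω ∂μ, ∑ n, ∑ t,
      (noiseVariance μ η n t - varianceEstimate (fhat ω) (ghat ω) n t) ^ 2 ≤
        2 * H₂ ω + 2 * (Q * H₁ ω) := by
    filter_upwards [hH₁, hH₂, hfb] with ω h₁ h₂ h₃
    calc ∑ n, ∑ t, (noiseVariance μ η n t - varianceEstimate (fhat ω) (ghat ω) n t) ^ 2
        ≤ ∑ n, ∑ t, (2 * (ghat ω n t - (f n t ^ 2 + noiseVariance μ η n t)) ^ 2 +
            2 * (Q * (fhat ω n t - f n t) ^ 2)) :=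
          Finset.sum_le_sum fun n _ => Finset.sum_le_sum fun t _ =>
            sq_sub_varianceEstimate_le (hv0 n t) (hfF n t) (h₃ n t)
      _ = 2 * (∑ n, ∑ t, (ghat ω n t - (f n t ^ 2 + noiseVariance μ η n t)) ^ 2) +
            2 * (Q * ∑ n, ∑ t, (fhat ω n t - f n t) ^ 2) := by
          simp only [Finset.sum_add_distrib, Finset.mul_sum]
      _ ≤ _ := by gcongr
  have hbi : Integrable (fun ω => 2 * H₂ ω + 2 * (Q * H₁ ω)) μ :=
    (hH₂i.const_mul _).add ((hH₁i.const_mul _).const_mul _)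
  have hint : ∀ n t, Integrable (fun ω =>
      (noiseVariance μ η n t - varianceEstimate (fhat ω) (ghat ω) n t) ^ 2) μ := by
    intro n t
    refine hbi.mono' ?_ ?_
    · have : AEMeasurable (fun ω => varianceEstimate (fhat ω) (ghat ω) n t) μ :=
        aemeasurable_const.max ((hgm n t).sub ((hfm n t).pow_const 2))
      exact ((this.const_sub _).pow_const 2).aestronglyMeasurable
    · filter_upwards [hpt] with ω hω
      rw [Real.norm_of_nonneg (sq_nonneg _)]
      refine le_trans ?_ hω
      calc (noiseVariance μ η n t - varianceEstimate (fhat ω) (ghat ω) n t) ^ 2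
          ≤ ∑ t, (noiseVariance μ η n t - varianceEstimate (fhat ω) (ghat ω) n t) ^ 2 :=
            Finset.single_le_sum (f := fun t =>
              (noiseVariance μ η n t - varianceEstimate (fhat ω) (ghat ω) n t) ^ 2)
              (fun _ _ => sq_nonneg _) (Finset.mem_univ t)
        _ ≤ _ := Finset.single_le_sum (f := fun n => ∑ t,
              (noiseVariance μ η n t - varianceEstimate (fhat ω) (ghat ω) n t) ^ 2)
              (fun _ _ => Finset.sum_nonneg fun _ _ => sq_nonneg _) (Finset.mem_univ n)
  refine ⟨hint, ?_⟩
  have hsum : ∑ n, ∑ t,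
      ∫ ω, (noiseVariance μ η n t - varianceEstimate (fhat ω) (ghat ω) n t) ^ 2 ∂μ ≤
        2 * ∫ ω, H₂ ω ∂μ + 2 * (Q * ∫ ω, H₁ ω ∂μ) := by
    have e : ∑ n, ∑ t,
        ∫ ω, (noiseVariance μ η n t - varianceEstimate (fhat ω) (ghat ω) n t) ^ 2 ∂μ =
        ∫ ω, ∑ n, ∑ t,
          (noiseVariance μ η n t - varianceEstimate (fhat ω) (ghat ω) n t) ^ 2 ∂μ := by
      rw [integral_finsetSum _ fun n _ => integrable_finsetSum _ fun t _ => hint n t]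
      exact Finset.sum_congr rfl fun n _ => (integral_finsetSum _ fun t _ => hint n t).symm
    rw [e, ← integral_const_mul, ← integral_const_mul, ← integral_const_mul,
      ← integral_add (hH₂i.const_mul _) ((hH₁i.const_mul _).const_mul _)]
    exact integral_mono_ae
      (integrable_finsetSum _ fun n _ => integrable_finsetSum _ fun t _ => hint n t) hbi hpt
  have hfr := hf.stackedPage_hasInnerDimLE hLT
  have hgr := stackedPage_sq_add_hasInnerDimLE hfr (hv.stackedPage_hasInnerDimLE hLT)
  obtain ⟨hr1, hr2, hr3⟩ := nat_rank_bounds (R := R) (G := G) (R' := R') (G' := G') hG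
  set κ : ℝ := (9 * (R : ℝ) ^ 2 + 2 * R') * ((G : ℝ) ^ 2 + G') with hκ
  have hk1 : (k₁ : ℝ) ≤ κ := by
    rw [hκ]
    exact_mod_cast hk₁'.trans (max_le (hfr.rank_le.trans hr2) hr3)
  have hk2 : (k₂ : ℝ) ≤ κ := by
    rw [hκ]
    exact_mod_cast hk₂'.trans (max_le (hgr.rank_le.trans hr1) hr3)
  set D : ℝ := (L : ℝ) + N * (T / L : ℕ) with hD
  have hdim : 1 / ((N : ℝ) * T) * D ≤ 3 / √(((min N T : ℕ) : ℝ) * T) :=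
    page_dimensions_le (by omega) hL hLT
  set ℓ : ℝ := Real.log ((N : ℝ) * T) ^ 2 with hℓ
  have hℓ0 : 0 ≤ ℓ := sq_nonneg _
  have hκ0 : 0 ≤ κ := by positivity
  calc 1 / ((N : ℝ) * T) * ∑ n, ∑ t,
        ∫ ω, (noiseVariance μ η n t - varianceEstimate (fhat ω) (ghat ω) n t) ^ 2 ∂μ
      ≤ 1 / ((N : ℝ) * T) * (2 * (720000 * κ * D * K₂ ^ 2 * ℓ) +
          2 * (Q * (720000 * κ * D * K₁ ^ 2 * ℓ))) := by
        gcongr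
        refine hsum.trans ?_
        gcongr
        · exact hH₂le.trans (by gcongr)
        · exact hH₁le.trans (by gcongr)
    _ = 1440000 * κ * (K₂ ^ 2 + Q * K₁ ^ 2) * ℓ * (1 / ((N : ℝ) * T) * D) := by ring
    _ ≤ 1440000 * κ * (K₂ ^ 2 + Q * K₁ ^ 2) * ℓ * (3 / √(((min N T : ℕ) : ℝ) * T)) := by
        gcongr
    _ = 4320000 * (9 * (R : ℝ) ^ 2 + 2 * R') * (K₂ ^ 2 + Q * K₁ ^ 2) *
          (((G : ℝ) ^ 2 + G') * ℓ / √(((min N T : ℕ) : ℝ) * T)) := by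
        rw [hκ]
        ring
    _ = _ := by
        congr 1
        simp only [map_add, map_mul, map_pow, MvPolynomial.eval_C, MvPolynomial.eval_X]
        simp [hF, hQ, hK₁, hK₂, Matrix.cons_val]
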